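/- Let $n\ge 1$ be an integer and $\mu>0$ a real number, and let $F(\theta)=\sqrt{\frac{1-\cos^{2n}\theta}{1-\cos^{2}\theta}}=\sqrt{\sum_{k=0}^{n-1}\cos^{2k}\theta}$ (the second expression defines $F$ where $\sin\theta=0$; thus $F(0)=\sqrt n$). Consider in $\mathbb{R}^3$ the autonomous system \begin{align*} \frac{d\theta}{d\bar\tau}&=-\frac{6\mu F(\theta)\,\bigl((T-1)\cos\theta+T\bigr)}{n}+\frac{3Q(T-1)F(\theta)^2\sin(2\theta)}{2n},\\ \frac{dT}{d\bar\tau}&=\frac{3Q(T-1)^2\,T\,\bigl(1-\cos^{2n}\theta\bigr)}{n},\\ \frac{dQ}{d\bar\tau}&=-3\,(Q^2-1)(T-1)\bigl(1-\cos^{2n}\theta\bigr), \end{align*} which describes the spatially flat Ho\v{r}ava--Lifshitz cosmology with $\Lambda\neq0$ under detailed balance and with the E-model potential $V(\phi)=V_0\bigl(1-e^{-\sqrt{2/(3\alpha)}\,\phi}\bigr)^{2n}$. Call an equilibrium $p$ of a system $x'=f(x)$ unstable if it is not Lyapunov stable (forward in time). Call it a saddle if $f$ is differentiable at $p$ and there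 are linear subspaces $S,U$ with $S\cap U=\{0\}$, both invariant under $Df(p)$, such that some solution on $[0,\infty)$ that never equals $p$ tends to $p$ as $\bar\tau\to+\infty$, tangentially to $p+S$, and some solution on $(-\infty,0]$ that never equals $p$ tends to $p$ as $\bar\tau\to-\infty$, tangentially to $p+U$. (For hyperbolic equilibria of $C^1$ vector fields this is the usual notion of a saddle.) Then: (i) The de Sitter point $dS^+$: $(\theta,T,Q)=(0,\tfrac12,1)$ is an unstable equilibrium and a saddle. (ii) For every real $Q^*\notin\{0,1,-1\}$, the point $(\theta,T,Q)=(0,\tfrac12,Q^*)$ of the line of equilibria $dS_+(Q^*)$ is an unstable equilibrium and a saddle. -/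

import Mathlib

open Filter Topology

noncomputable section

/-! ### Equilibria of autonomous differential equations `x' = f x` -/

/-- Lyapunov stability (forward in time) of the point `p` for `x' = f x`: solutions that start close
to `p` remain close to `p`, for as long as they exist. -/
def IsLyapunovStable {E : Type*} [NormedAddCommGroup E] [NormedSpace ℝ E]
    (f : E → E) (p : E) : Prop :=
  ∀ ε > 0, ∃ δ > 0, ∀ (x : ℝ → E) (b : ℝ),
    IsIntegralCurveOn x (fun _ => f) (Set.Icc 0 b) → dist (x 0) p < δ →
      ∀ τ ∈ Set.Icc 0 b, dist (x τ) p < ε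

/-- An unstable equilibrium: an equilibrium that is not Lyapunov stable. -/
def IsUnstableEquilibrium {E : Type*} [NormedAddCommGroup E] [NormedSpace ℝ E]
    (f : E → E) (p : E) : Prop :=
  f p = 0 ∧ ¬ IsLyapunovStable f p

/-- The curve `x` tends to `p` along the filter `l`, never reaching `p`, and does so tangentially
to the affine subspace `p + S`. -/
def TendsTangentially {E : Type*} [NormedAddCommGroup E] [NormedSpace ℝ E]
    (x : ℝ → E) (l : Filter ℝ) (p : E) (S : Submodule ℝ E) : Prop :=
  (∀ τ, x τ ≠ p) ∧ Tendsto x l (𝓝 p) ∧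
    Tendsto (fun τ => Metric.infDist (x τ - p) (S : Set E) / ‖x τ - p‖) l (𝓝 0)

/-- A (possibly non-hyperbolic) saddle of `x' = f x`: an equilibrium `p` that attracts some orbit
and repels some orbit, along independent invariant directions of the linearization.
That is, there are subspaces `S` and `U`, invariant under `Df(p)` and with `S ∩ U = 0`, a
nonconstant solution on `[0, ∞)` that tends to `p` in the future, tangentially to `S`, and a
nonconstant solution on `(-∞, 0]` that tends to `p` in the past, tangentially to `U`.
For a hyperbolic equilibrium this says that `Df(p)` has eigenvalues with negative real part and
eigenvalues with positive real part. -/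
def IsSaddle {E : Type*} [NormedAddCommGroup E] [NormedSpace ℝ E] (f : E → E) (p : E) : Prop :=
  f p = 0 ∧ DifferentiableAt ℝ f p ∧
    ∃ S U : Submodule ℝ E,
      (∀ v ∈ S, fderiv ℝ f p v ∈ S) ∧ (∀ v ∈ U, fderiv ℝ f p v ∈ U) ∧ S ⊓ U = ⊥ ∧
      (∃ x : ℝ → E, IsIntegralCurveOn x (fun _ => f) (Set.Ici 0) ∧
        TendsTangentially x atTop p S) ∧
      (∃ y : ℝ → E, IsIntegralCurveOn y (fun _ => f) (Set.Iic 0) ∧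
        TendsTangentially y atBot p U)

/-! ### The flat model with nonzero cosmological constant and E-model potential -/

/-- The continuous function `F(θ) = √((1 - cos²ⁿ θ) / (1 - cos² θ))`, extended to the zeros of
`sin θ` through `(1 - cos²ⁿ θ) / (1 - cos² θ) = ∑_{k < n} cos²ᵏ θ`. -/
def eModelF (n : ℕ) (θ : ℝ) : ℝ :=
  Real.sqrt (∑ k ∈ Finset.range n, Real.cos θ ^ (2 * k))

theorem eModelF_eq (n : ℕ) (θ : ℝ) (h : Real.cos θ ^ 2 ≠ 1) :
    eModelF n θ = Real.sqrt ((1 - Real.cos θ ^ (2 * n)) / (1 - Real.cos θ ^ 2)) := by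
  have h1 : (1 : ℝ) - Real.cos θ ^ 2 ≠ 0 := sub_ne_zero.mpr (Ne.symm h)
  have h2 := geom_sum_mul_neg (Real.cos θ ^ 2) n
  unfold eModelF
  congr 1
  rw [eq_div_iff h1]
  simpa only [pow_mul] using h2

/-- The vector field in the variables `(θ, T, Q)`, with respect to the rescaled time `τ`. -/
def eModelField (n : ℕ) (μ : ℝ) : ℝ × ℝ × ℝ → ℝ × ℝ × ℝ := fun (θ, T, Q) =>
  (-(6 * μ * eModelF n θ * ((T - 1) * Real.cos θ + T)) / n
      + 3 * Q * (T - 1) * eModelF n θ ^ 2 * Real.sin (2 * θ) / (2 * n),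
    3 * Q * (T - 1) ^ 2 * T * (1 - Real.cos θ ^ (2 * n)) / n,
    -3 * (Q ^ 2 - 1) * (T - 1) * (1 - Real.cos θ ^ (2 * n)))

end

/-! The linearization at `(0, 1/2, Q)` has rank one, with eigenvalues `-3Q/2, 0, 0`, so hyperbolic
theory does not apply and the two required orbits are built by hand. The equations for `T` and `Q`
share the factor `1 - cos²ⁿ θ`; dividing them gives the separable equation `dQ/dT = n (Q² - 1) / (Q
T (1 - T))`. Hence `(Q² - 1) ((1 - T)/T)²ⁿ` is constant along orbits, and each equilibrium with `Q >
0` lies on an invariant surface `Q = q(T - 1/2)` (`eModelLeaf`); for `Q = 1` this is the plane `Q =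
1`.

On that surface, with `x = θ` and `y = T - 1/2`, the system is planar: `x' = X = -lam x - a y +
O(2)`, where `lam = 3Q/2` and `a = 12μ/√n`, and `y' = Y`, where `0 < Y ≤ C x²` for `x ≠ 0`. A strong
stable orbit is a solution of `dy/dx = Y/X` between the barriers `-K x²` and `0`
(`exists_strongStable_graph`). A center orbit over `y > 0` is a solution of `dx/dy = X/Y` between
`-(a/lam) y ± K y²` (`exists_center_graph`); since `Y > 0`, it leaves the equilibrium. Both scalar
equations are singular at `0`, and `exists_solution_of_singular_endpoint` handles them by a monotone
limit of solutions that start on the lower barrier.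

`HasEnteringCurve.exists_solution` turns these graphs into solutions in time. The tangent directions
are eigenvectors for `-lam` and `0`, which gives the saddle. The case `Q < 0` follows from the
time-reversing symmetry `(θ, T, Q) ↦ (-θ, T, -Q)`, and instability from the orbit that emanates from
the equilibrium. -/

noncomputable section

/-! ### Scalar equations with barriers -/

/-- The region between two continuous graphs over a compact interval is compact. -/
theorem isCompact_setOf_between {α β : ℝ → ℝ} (hα : Continuous α) (hβ : Continuous β) (a b : ℝ) :
    IsCompact {z : ℝ × ℝ | z.1 ∈ Set.Icc a b ∧ z.2 ∈ Set.Icc (α z.1) (β z.1)} := by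
  obtain ⟨m, hm⟩ := (isCompact_Icc (a := a) (b := b)).bddBelow_image hα.continuousOn
  obtain ⟨M, hM⟩ := (isCompact_Icc (a := a) (b := b)).bddAbove_image hβ.continuousOn
  refine ((isCompact_Icc (a := a) (b := b)).prod (isCompact_Icc (a := m) (b := M))).of_isClosed_subset
    ?_ ?_
  · refine (isClosed_Icc.preimage continuous_fst).inter ?_
    exact (isClosed_le (hα.comp continuous_fst) continuous_snd).inter
      (isClosed_le continuous_snd (hβ.comp continuous_fst))
  · rintro z ⟨h1, h2⟩
    exact ⟨h1, (hm (Set.mem_image_of_mem _ h1)).trans h2.1,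
      h2.2.trans (hM (Set.mem_image_of_mem _ h1))⟩

/-- A function that is `C¹` around a compact region between two graphs is Lipschitz on it. -/
theorem exists_lipschitzOnWith_between {G : ℝ → ℝ → ℝ} {α β : ℝ → ℝ} {a b : ℝ}
    (hα : Continuous α) (hβ : Continuous β)
    (hG : ∀ s ∈ Set.Icc a b, ∀ y ∈ Set.Icc (α s) (β s),
      ContDiffAt ℝ 1 (fun z : ℝ × ℝ => G z.1 z.2) (s, y)) :
    ∃ K, LipschitzOnWith K (fun z : ℝ × ℝ => G z.1 z.2)
      {z | z.1 ∈ Set.Icc a b ∧ z.2 ∈ Set.Icc (α z.1) (β z.1)} := by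
  refine LocallyLipschitzOn.exists_lipschitzOnWith_of_compact (isCompact_setOf_between hα hβ a b) ?_
  rintro ⟨s, y⟩ ⟨h1, h2⟩
  obtain ⟨K, t, ht, hK⟩ := (hG s h1 y h2).exists_lipschitzOnWith
  exact ⟨K, t, mem_nhdsWithin_of_mem_nhds ht, hK⟩

/-- A solution that starts between a lower and an upper barrier stays between them. -/
theorem exists_solution_between_barriers {G : ℝ → ℝ → ℝ} {α β α' β' : ℝ → ℝ} {a b : ℝ}
    (hab : a < b) (hα : ∀ s, HasDerivAt α (α' s) s) (hβ : ∀ s, HasDerivAt β (β' s) s)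
    (hαβ : ∀ s ∈ Set.Icc a b, α s ≤ β s)
    (hG : ∀ s ∈ Set.Icc a b, ∀ y ∈ Set.Icc (α s) (β s),
      ContDiffAt ℝ 1 (fun z : ℝ × ℝ => G z.1 z.2) (s, y))
    (hlow : ∀ s ∈ Set.Icc a b, α' s < G s (α s)) (hup : ∀ s ∈ Set.Icc a b, G s (β s) < β' s) :
    ∃ y : ℝ → ℝ, y a = α a ∧ ∀ s ∈ Set.Icc a b,
      HasDerivWithinAt y (G s (y s)) (Set.Icc a b) s ∧ y s ∈ Set.Icc (α s) (β s) := by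
  have hαc : Continuous α := continuous_iff_continuousAt.2 fun s => (hα s).continuousAt
  have hβc : Continuous β := continuous_iff_continuousAt.2 fun s => (hβ s).continuousAt
  obtain ⟨K, hK⟩ := exists_lipschitzOnWith_between hαc hβc hG
  set D : Set (ℝ × ℝ) := {z | z.1 ∈ Set.Icc a b ∧ z.2 ∈ Set.Icc (α z.1) (β z.1)} with hD
  -- Clamping `y` to the region makes the right-hand side bounded and globally Lipschitz in `y`, so
  -- that Picard–Lindelöf covers all of `[a, b]`. The barriers show afterwards that the clamp is
  -- inactive.
  let c : ℝ → ℝ → ℝ := fun s y => max (α s) (min (β s) y)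
  have hcD : ∀ s ∈ Set.Icc a b, ∀ y, (s, c s y) ∈ D := fun s hs y =>
    ⟨hs, le_max_left _ _, max_le (hαβ s hs) (min_le_left _ _)⟩
  have hcc : Continuous fun z : ℝ × ℝ => c z.1 z.2 := by fun_prop
  have hGc : ContinuousOn (fun z : ℝ × ℝ => G z.1 (c z.1 z.2)) (Set.Icc a b ×ˢ Set.univ) := by
    refine hK.continuousOn.comp (f := fun z : ℝ × ℝ => (z.1, c z.1 z.2)) (by fun_prop) ?_
    rintro ⟨s, y⟩ ⟨hs, -⟩
    exact hcD s hs y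
  have hlip : ∀ s ∈ Set.Icc a b, LipschitzWith K (fun y => G s (c s y)) := by
    intro s hs
    refine LipschitzWith.of_dist_le_mul fun y₁ y₂ => ?_
    refine (hK.dist_le_mul _ (hcD s hs y₁) _ (hcD s hs y₂)).trans ?_
    gcongr
    have h1 : LipschitzWith 1 (c s) := (LipschitzWith.id.const_min (β s)).const_max (α s)
    simpa [Prod.dist_eq] using h1.dist_le_mul y₁ y₂
  have hDb : Bornology.IsBounded ((fun z : ℝ × ℝ => G z.1 z.2) '' D) :=
    ((isCompact_setOf_between hαc hβc a b).image_of_continuousOn hK.continuousOn).isBounded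
  obtain ⟨L, hL⟩ := hDb.exists_norm_le
  have ha : a ∈ Set.Icc a b := Set.left_mem_Icc.2 hab.le
  have hL0 : 0 ≤ L := (norm_nonneg _).trans (hL _ ⟨_, hcD a ha 0, rfl⟩)
  have hPL : IsPicardLindelof (fun s y => G s (c s y)) (⟨a, ha⟩ : Set.Icc a b) (α a)
      (⟨L * (b - a), mul_nonneg hL0 (sub_nonneg.2 hab.le)⟩) 0 ⟨L, hL0⟩ K :=
    { lipschitzOnWith := fun s hs => (hlip s hs).lipschitzOnWith
      continuousOn := fun y _ =>
        hGc.comp (f := fun s : ℝ => (s, y)) (by fun_prop) fun s hs => ⟨hs, trivial⟩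
      norm_le := fun s hs y _ => hL _ ⟨_, hcD s hs y, rfl⟩
      mul_max_le := by
        have : max (b - a) (a - a) = b - a := by simp [hab.le]
        simp only [this, NNReal.coe_zero, sub_zero]
        exact le_rfl }
  obtain ⟨y, hya, hy⟩ := hPL.exists_eq_forall_mem_Icc_hasDerivWithinAt₀
  have hyc : ContinuousOn y (Set.Icc a b) := fun s hs => (hy s hs).continuousWithinAt
  have hy' : ∀ s ∈ Set.Ico a b, HasDerivWithinAt y (G s (c s (y s))) (Set.Ici s) s := fun s hs =>
    (hy s (Set.Ico_subset_Icc_self hs)).mono_of_mem_nhdsWithin (Icc_mem_nhdsGE_of_mem hs)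
  have hmem : ∀ s ∈ Set.Icc a b, y s ∈ Set.Icc (α s) (β s) := by
    intro s hs
    constructor
    -- Slopes need comparing only at contact points, and there the clamped value is the barrier
    -- itself.
    · refine image_le_of_deriv_right_lt_deriv_boundary' hαc.continuousOn
        (fun s _ => (hα s).hasDerivWithinAt) hya.ge hyc hy' (fun s hs h => ?_) hs
      have hs' := Set.Ico_subset_Icc_self hs
      have : c s (y s) = α s := by simp [c, ← h, hαβ s hs']
      rw [this]
      exact hlow s hs'
    · refine image_le_of_deriv_right_lt_deriv_boundary' hyc hy' (hya.trans_le (hαβ a ha))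
        hβc.continuousOn (fun s _ => (hβ s).hasDerivWithinAt) (fun s hs h => ?_) hs
      have hs' := Set.Ico_subset_Icc_self hs
      have : c s (y s) = β s := by simp [c, h, hαβ s hs']
      rw [this]
      exact hup s hs'
  refine ⟨y, hya, fun s hs => ⟨?_, hmem s hs⟩⟩
  have : c s (y s) = y s := by simp [c, (hmem s hs).1, (hmem s hs).2]
  simpa only [this] using hy s hs

/-- Solutions of a scalar equation are ordered like their initial values. -/
theorem solution_le_solution {G : ℝ → ℝ → ℝ} {α β : ℝ → ℝ} {a b : ℝ} {K : NNReal}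
    (hK : LipschitzOnWith K (fun z : ℝ × ℝ => G z.1 z.2)
      {z | z.1 ∈ Set.Icc a b ∧ z.2 ∈ Set.Icc (α z.1) (β z.1)})
    {y₁ y₂ : ℝ → ℝ}
    (h₁ : ∀ s ∈ Set.Icc a b, HasDerivWithinAt y₁ (G s (y₁ s)) (Set.Icc a b) s ∧
      y₁ s ∈ Set.Icc (α s) (β s))
    (h₂ : ∀ s ∈ Set.Icc a b, HasDerivWithinAt y₂ (G s (y₂ s)) (Set.Icc a b) s ∧
      y₂ s ∈ Set.Icc (α s) (β s))
    (h : y₁ a ≤ y₂ a) : ∀ s ∈ Set.Icc a b, y₁ s ≤ y₂ s := by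
  -- The rate `K + 1` instead of `K` makes the derivative inequality strict at a contact point,
  -- where the two solutions differ by exactly the exponential term.
  have key : ∀ η > 0, ∀ s ∈ Set.Icc a b, y₁ s ≤ y₂ s + η * Real.exp ((K + 1) * s) := by
    intro η hη s hs
    have he : ∀ s : ℝ, HasDerivAt (fun s => η * Real.exp ((K + 1) * s))
        (η * (Real.exp ((K + 1) * s) * (K + 1))) s := fun s => by
      simpa using (((hasDerivAt_id s).const_mul ((K : ℝ) + 1)).exp).const_mul η
    have hr : ∀ {y : ℝ → ℝ}, (∀ s ∈ Set.Icc a b, HasDerivWithinAt y (G s (y s)) (Set.Icc a b) s ∧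
        y s ∈ Set.Icc (α s) (β s)) →
        ∀ s ∈ Set.Ico a b, HasDerivWithinAt y (G s (y s)) (Set.Ici s) s := fun h s hs =>
      (h s (Set.Ico_subset_Icc_self hs)).1.mono_of_mem_nhdsWithin (Icc_mem_nhdsGE_of_mem hs)
    refine image_le_of_deriv_right_lt_deriv_boundary' (fun s hs => (h₁ s hs).1.continuousWithinAt)
      (hr h₁) (B := fun s => y₂ s + η * Real.exp ((K + 1) * s))
      (B' := fun s => G s (y₂ s) + η * (Real.exp ((K + 1) * s) * (K + 1))) ?_
      (fun s hs => (h₂ s hs).1.continuousWithinAt.add (he s).continuousAt.continuousWithinAt)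
      (fun s hs => (hr h₂ s hs).add (he s).hasDerivWithinAt) ?_ hs
    · have : 0 < η * Real.exp ((K + 1) * a) := by positivity
      linarith
    · intro s hs heq
      have hs' := Set.Ico_subset_Icc_self hs
      have h3 := hK.dist_le_mul (s, y₁ s) ⟨hs', (h₁ s hs').2⟩ (s, y₂ s) ⟨hs', (h₂ s hs').2⟩
      have hpos : 0 < η * Real.exp ((K + 1) * s) := by positivity
      have h4 : dist (s, y₁ s) (s, y₂ s) = η * Real.exp ((K + 1) * s) := by
        rw [Prod.dist_eq, dist_self, Real.dist_eq, heq, add_sub_cancel_left, abs_of_pos hpos,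
          max_eq_right hpos.le]
      rw [h4, Real.dist_eq] at h3
      have h5 := (le_abs_self _).trans h3
      dsimp only at h5
      nlinarith
  intro s hs
  refine le_of_forall_pos_le_add fun ε hε => ?_
  have := key (ε * Real.exp (-((K + 1) * s))) (by positivity) s hs
  rwa [mul_assoc, ← Real.exp_add, neg_add_cancel, Real.exp_zero, mul_one] at this

/-- A pointwise limit of solutions of a scalar equation that stay in a compact region is again a
solution. -/
theorem hasDerivAt_of_tendsto_solution {G : ℝ → ℝ → ℝ} {α β : ℝ → ℝ} {a b : ℝ}
    (hα : Continuous α) (hβ : Continuous β)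
    (hG : ∀ s ∈ Set.Icc a b, ∀ y ∈ Set.Icc (α s) (β s),
      ContDiffAt ℝ 1 (fun z : ℝ × ℝ => G z.1 z.2) (s, y))
    {Y : ℕ → ℝ → ℝ} {y : ℝ → ℝ}
    (hY : ∀ᶠ k in atTop, ∀ s ∈ Set.Icc a b,
      HasDerivWithinAt (Y k) (G s (Y k s)) (Set.Icc a b) s ∧ Y k s ∈ Set.Icc (α s) (β s))
    (hlim : ∀ s ∈ Set.Icc a b, Tendsto (fun k => Y k s) atTop (𝓝 (y s)))
    {s : ℝ} (hs : s ∈ Set.Ioo a b) : HasDerivAt y (G s (y s)) s := by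
  obtain ⟨K, hK⟩ := exists_lipschitzOnWith_between hα hβ hG
  set D : Set (ℝ × ℝ) := {z | z.1 ∈ Set.Icc a b ∧ z.2 ∈ Set.Icc (α z.1) (β z.1)} with hD
  obtain ⟨M, hM⟩ :=
    ((isCompact_setOf_between hα hβ a b).image_of_continuousOn hK.continuousOn).isBounded.exists_norm_le
  have hyD : ∀ t ∈ Set.Icc a b, (t, y t) ∈ D := fun t ht =>
    ⟨ht, isClosed_Icc.mem_of_tendsto (hlim t ht) (hY.mono fun k hk => (hk t ht).2)⟩
  -- The approximating solutions share the Lipschitz constant `M`, a bound for `G` on the region,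
  -- and the limit inherits it.
  have hyc : ContinuousOn y (Set.Icc a b) := by
    have hM0 : 0 ≤ M := (norm_nonneg _).trans
      (hM _ ⟨_, hyD s (Set.Ioo_subset_Icc_self hs), rfl⟩)
    refine (LipschitzOnWith.of_dist_le_mul (K := ⟨M, hM0⟩) fun t ht t' ht' => ?_).continuousOn
    refine le_of_tendsto ((hlim t ht).dist (hlim t' ht')) (hY.mono fun k hk => ?_)
    rw [dist_eq_norm, dist_eq_norm]
    exact (convex_Icc a b).norm_image_sub_le_of_norm_hasDerivWithin_le (fun u hu => (hk u hu).1)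
      (fun u hu => hM _ ⟨(u, Y k u), ⟨hu, (hk u hu).2⟩, rfl⟩) ht' ht
  have hGy : ContinuousOn (fun t => G t (y t)) (Set.Icc a b) :=
    hK.continuousOn.comp (f := fun t => (t, y t)) (continuousOn_id.prodMk hyc) hyD
  -- The integral form of the equation passes to the limit by dominated convergence; no convergence
  -- of derivatives is needed.
  have hint : ∀ t ∈ Set.Icc a b, y t = y a + ∫ u in a..t, G u (y u) := by
    intro t ht
    have hsub : Set.Icc a t ⊆ Set.Icc a b := Set.Icc_subset_Icc_right ht.2
    have hIoc : Set.uIoc a t ⊆ Set.Icc a t := by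
      rw [Set.uIoc_of_le ht.1]; exact Set.Ioc_subset_Icc_self
    have ha : a ∈ Set.Icc a b := ⟨le_rfl, ht.1.trans ht.2⟩
    have hGk : ∀ᶠ k in atTop, ContinuousOn (fun u => G u (Y k u)) (Set.Icc a t) :=
      hY.mono fun k hk => (hK.continuousOn.comp (f := fun u => (u, Y k u))
        (continuousOn_id.prodMk fun u hu => (hk u hu).1.continuousWithinAt)
        fun u hu => ⟨hu, (hk u hu).2⟩).mono hsub
    have h1 : Tendsto (fun k => ∫ u in a..t, G u (Y k u)) atTop (𝓝 (∫ u in a..t, G u (y u))) := by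
      refine intervalIntegral.tendsto_integral_filter_of_dominated_convergence (fun _ => M) ?_ ?_
        intervalIntegrable_const ?_
      · filter_upwards [hGk] with k hk
        exact (hk.mono hIoc).aestronglyMeasurable measurableSet_uIoc
      · filter_upwards [hY] with k hk
        exact MeasureTheory.ae_of_all _ fun u hu =>
          hM _ ⟨(u, Y k u), ⟨hsub (hIoc hu), (hk u (hsub (hIoc hu))).2⟩, rfl⟩
      · refine MeasureTheory.ae_of_all _ fun u hu => ?_
        have hu' := hsub (hIoc hu)
        refine (hK.continuousOn _ (hyD u hu')).tendsto.comp (tendsto_nhdsWithin_iff.2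
          ⟨tendsto_const_nhds.prodMk_nhds (hlim u hu'), hY.mono fun k hk => ⟨hu', (hk u hu').2⟩⟩)
    have h2 : Tendsto (fun k => Y k t - Y k a) atTop (𝓝 (y t - y a)) :=
      (hlim t ht).sub (hlim a ha)
    have h3 : ∀ᶠ k in atTop, ∫ u in a..t, G u (Y k u) = Y k t - Y k a := by
      filter_upwards [hY, hGk] with k hk hGk
      refine intervalIntegral.integral_eq_sub_of_hasDerivAt_of_le ht.1
        (fun u hu => ((hk u (hsub hu)).1.mono hsub).continuousWithinAt) (fun u hu => ?_)
        (hGk.intervalIntegrable_of_Icc ht.1)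
      exact (hk u (hsub (Set.Ioo_subset_Icc_self hu))).1.hasDerivAt
        (Icc_mem_nhds hu.1 (hu.2.trans_le ht.2))
    have := tendsto_nhds_unique (h1.congr' h3) h2
    linarith
  have hnhds : Set.Icc a b ∈ 𝓝 s := Icc_mem_nhds hs.1 hs.2
  have hd : HasDerivAt (fun t => ∫ u in a..t, G u (y u)) (G s (y s)) s := by
    refine intervalIntegral.integral_hasDerivAt_right ?_ ?_ (hGy.continuousAt hnhds)
    · exact (hGy.mono (Set.Icc_subset_Icc_right hs.2.le)).intervalIntegrable_of_Icc hs.1.le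
    · exact ⟨_, hnhds, hGy.aestronglyMeasurable measurableSet_Icc⟩
  refine (hd.const_add (y a)).congr_of_eventuallyEq ?_
  filter_upwards [hnhds] with t ht using hint t ht

/-- A scalar equation on `(0, r)`, possibly singular at `0`, has a solution between a strict lower
and a strict upper barrier. -/
theorem exists_solution_of_singular_endpoint {G : ℝ → ℝ → ℝ} {α β α' β' : ℝ → ℝ} {r : ℝ}
    (hr : 0 < r) (hα : ∀ s, HasDerivAt α (α' s) s) (hβ : ∀ s, HasDerivAt β (β' s) s)
    (hαβ : ∀ s ∈ Set.Ioc 0 r, α s ≤ β s)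
    (hG : ∀ s ∈ Set.Ioc 0 r, ∀ y ∈ Set.Icc (α s) (β s),
      ContDiffAt ℝ 1 (fun z : ℝ × ℝ => G z.1 z.2) (s, y))
    (hlow : ∀ s ∈ Set.Ioc 0 r, α' s < G s (α s)) (hup : ∀ s ∈ Set.Ioc 0 r, G s (β s) < β' s) :
    ∃ y : ℝ → ℝ, ∀ s ∈ Set.Ioo 0 r, HasDerivAt y (G s (y s)) s ∧ y s ∈ Set.Icc (α s) (β s) := by
  have hαc : Continuous α := continuous_iff_continuousAt.2 fun s => (hα s).continuousAt
  have hβc : Continuous β := continuous_iff_continuousAt.2 fun s => (hβ s).continuousAt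
  -- The shift by `2` gives `ε k < r` already for `k = 0`.
  let ε : ℕ → ℝ := fun k => r / (k + 2)
  have hε0 : ∀ k, 0 < ε k := fun k => by positivity
  have hεr : ∀ k, ε k < r := fun k => div_lt_self hr (by linarith [k.cast_nonneg (α := ℝ)])
  have hεa : ∀ k, ε (k + 1) ≤ ε k := fun k => by
    dsimp only [ε]; gcongr; simp
  have hεlim : Tendsto ε atTop (𝓝 0) :=
    tendsto_const_nhds.div_atTop
      (tendsto_atTop_add_const_right _ _ tendsto_natCast_atTop_atTop)
  have hsub : ∀ {a : ℝ}, 0 < a → Set.Icc a r ⊆ Set.Ioc 0 r := fun ha s hs =>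
    ⟨ha.trans_le hs.1, hs.2⟩
  have hex := fun k => exists_solution_between_barriers (G := G) (hεr k) hα hβ
    (fun s hs => hαβ s (hsub (hε0 k) hs)) (fun s hs => hG s (hsub (hε0 k) hs))
    (fun s hs => hlow s (hsub (hε0 k) hs)) (fun s hs => hup s (hsub (hε0 k) hs))
  choose z hz0 hz using hex
  let Y : ℕ → ℝ → ℝ := fun k s => if ε k ≤ s then z k s else α s
  have hYeq : ∀ {k s}, ε k ≤ s → Y k s = z k s := fun h => if_pos h
  have hYmem : ∀ k, ∀ s ∈ Set.Ioc 0 r, Y k s ∈ Set.Icc (α s) (β s) := by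
    intro k s hs
    by_cases h : ε k ≤ s
    · rw [hYeq h]; exact (hz k s ⟨h, hs.2⟩).2
    · simp only [Y, if_neg h]; exact ⟨le_rfl, hαβ s hs⟩
  -- At `ε k` the `k`-th solution is on the lower barrier and the next one on or above it; this
  -- order persists to the right.
  have hmono : ∀ s ∈ Set.Ioc 0 r, Monotone fun k => Y k s := by
    intro s hs
    refine monotone_nat_of_le_succ fun k => ?_
    by_cases h : ε k ≤ s
    · obtain ⟨K, hK⟩ := exists_lipschitzOnWith_between (G := G) hαc hβc
        (fun s hs => hG s (hsub (hε0 k) hs))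
      have hss : Set.Icc (ε k) r ⊆ Set.Icc (ε (k + 1)) r := Set.Icc_subset_Icc_left (hεa k)
      rw [hYeq h, hYeq ((hεa k).trans h)]
      refine solution_le_solution hK (hz k)
        (fun t ht => ⟨(hz (k + 1) t (hss ht)).1.mono hss, (hz (k + 1) t (hss ht)).2⟩) ?_ s ⟨h, hs.2⟩
      rw [hz0 k]
      exact (hz (k + 1) (ε k) ⟨hεa k, (hεr k).le⟩).2.1
    · simp only [Y, if_neg h]
      exact (hYmem (k + 1) s hs).1
  have hlim : ∀ s ∈ Set.Ioc 0 r, Tendsto (fun k => Y k s) atTop (𝓝 (⨆ k, Y k s)) := fun s hs =>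
    tendsto_atTop_ciSup (hmono s hs) ⟨β s, Set.forall_mem_range.2 fun k => (hYmem k s hs).2⟩
  refine ⟨fun s => ⨆ k, Y k s, fun s hs => ⟨?_, ?_⟩⟩
  · have h2 : 0 < s / 2 := half_pos hs.1
    refine hasDerivAt_of_tendsto_solution (a := s / 2) (b := r) (Y := Y)
      (y := fun s => ⨆ k, Y k s) hαc hβc
      (fun t ht => hG t (hsub h2 ht)) ?_ (fun t ht => hlim t (hsub h2 ht))
      ⟨half_lt_self hs.1, hs.2⟩
    filter_upwards [hεlim.eventually_le_const h2] with k hk t ht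
    have hss : Set.Icc (s / 2) r ⊆ Set.Icc (ε k) r := Set.Icc_subset_Icc_left hk
    refine ⟨?_, hYmem k t (hsub h2 ht)⟩
    rw [hYeq (hk.trans ht.1)]
    exact ((hz k t (hss ht)).1.mono hss).congr (fun u hu => hYeq (hk.trans hu.1))
      (hYeq (hk.trans ht.1))
  · have hs' := Set.Ioo_subset_Ioc_self hs
    exact isClosed_Icc.mem_of_tendsto (hlim s hs') (Eventually.of_forall fun k => hYmem k s hs')

/-! ### Solutions that enter an equilibrium along a curve -/

/-- A scalar equation with positive bounded continuous right hand side has global solutions, and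
these tend to infinity. -/
theorem exists_solution_tendsto_atTop {V : ℝ → ℝ} (hV : Continuous V) (hpos : ∀ ξ, 0 < V ξ) {C : ℝ}
    (hC : ∀ ξ, V ξ ≤ C) (x₀ : ℝ) :
    ∃ x : ℝ → ℝ, x 0 = x₀ ∧ (∀ t, HasDerivAt x (V (x t)) t) ∧ Tendsto x atTop atTop := by
  have hC0 : 0 < C := (hpos 0).trans_le (hC 0)
  have hVi : Continuous fun ξ => (V ξ)⁻¹ := hV.inv₀ fun ξ => (hpos ξ).ne'
  -- `T ξ` is the time of travel from `x₀` to `ξ`; the solution is its inverse. The bound `V ≤ C`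
  -- makes `T` grow at rate at least `1/C`, hence surjective.
  let T : ℝ → ℝ := fun ξ => ∫ u in x₀..ξ, (V u)⁻¹
  have hT : ∀ ξ, HasDerivAt T (V ξ)⁻¹ ξ := fun ξ => hVi.integral_hasStrictDerivAt x₀ ξ |>.hasDerivAt
  have hTx : T x₀ = 0 := intervalIntegral.integral_same
  have hTmono : StrictMono T := strictMono_of_deriv_pos fun ξ => by
    rw [(hT ξ).deriv]; exact inv_pos.2 (hpos ξ)
  have hTc : Continuous T := continuous_iff_continuousAt.2 fun ξ => (hT ξ).continuousAt
  have hmono : Monotone fun ξ => T ξ - C⁻¹ * (ξ - x₀) := by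
    have hd : ∀ ξ, HasDerivAt (fun ξ => T ξ - C⁻¹ * (ξ - x₀)) ((V ξ)⁻¹ - C⁻¹) ξ := fun ξ => by
      have := (hT ξ).fun_sub (((hasDerivAt_id ξ).sub_const x₀).const_mul C⁻¹)
      rwa [mul_one] at this
    refine monotone_of_deriv_nonneg (fun ξ => (hd ξ).differentiableAt) fun ξ => ?_
    rw [(hd ξ).deriv]
    exact sub_nonneg.2 (inv_anti₀ (hpos ξ) (hC ξ))
  have htop : Tendsto T atTop atTop := by
    refine tendsto_atTop_mono' atTop ?_
      ((tendsto_atTop_add_const_right atTop (-x₀) tendsto_id).const_mul_atTop (inv_pos.2 hC0))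
    filter_upwards [eventually_ge_atTop x₀] with ξ hξ
    have := hmono hξ
    simp only [hTx, sub_self, mul_zero] at this
    simp only [id]; linarith
  have hbot : Tendsto T atBot atBot := by
    refine tendsto_atBot_mono' atBot ?_
      ((tendsto_atBot_add_const_right atBot (-x₀) tendsto_id).const_mul_atBot (inv_pos.2 hC0))
    filter_upwards [eventually_le_atBot x₀] with ξ hξ
    have := hmono hξ
    simp only [hTx, sub_self, mul_zero] at this
    simp only [id]; linarith
  let e : ℝ ≃o ℝ := hTmono.orderIsoOfSurjective T (hTc.surjective htop hbot)
  have he : ∀ t, T (e.symm t) = t := fun t => e.apply_symm_apply t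
  refine ⟨e.symm, ?_, fun t => ?_, e.symm.tendsto_atTop⟩
  · exact hTmono.injective ((he 0).trans hTx.symm)
  · have := HasDerivAt.of_local_left_inverse (f := T) (g := e.symm) (a := t)
      e.symm.continuous.continuousAt (hT _) (inv_pos.2 (hpos _)).ne' (Eventually.of_forall he)
    simpa using this

section EnteringCurves

variable {E : Type*} [NormedAddCommGroup E] [NormedSpace ℝ E]

/-- There is an orbit of `x' = f x` along a curve `γ` that ends at `p` with tangent vector `v`;
along the curve, the parameter `s` moves with velocity `Φ s < 0`, of size at most `C s`. -/
def HasEnteringCurve (f : E → E) (p v : E) : Prop :=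
  ∃ (γ γ' : ℝ → E) (Φ : ℝ → ℝ) (r C : ℝ), 0 < r ∧ γ 0 = p ∧ HasDerivWithinAt γ v (Set.Ici 0) 0 ∧
    ContinuousOn Φ (Set.Ioc 0 r) ∧ ∀ s ∈ Set.Ioc 0 r,
      γ s ≠ p ∧ Φ s < 0 ∧ -(C * s) ≤ Φ s ∧ HasDerivAt γ (γ' s) s ∧ f (γ s) = Φ s • γ' s

/-- The image curve keeps the speed `Φ`, and injectivity keeps it off `L p`. This transports orbits
from `Q > 0` to `Q < 0`. -/
theorem HasEnteringCurve.map {f g : E → E} {p v : E} (h : HasEnteringCurve f p v) (L : E →L[ℝ] E)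
    (hL : Function.Injective L) (hfg : ∀ z, g (L z) = L (f z)) :
    HasEnteringCurve g (L p) (L v) := by
  obtain ⟨γ, γ', Φ, r, C, hr, h0, hv, hΦ, h⟩ := h
  refine ⟨fun s => L (γ s), fun s => L (γ' s), Φ, r, C, hr, by simp [h0],
    L.hasFDerivAt.comp_hasDerivWithinAt 0 hv, hΦ, fun s hs => ?_⟩
  obtain ⟨h1, h2, h3, h4, h5⟩ := h s hs
  exact ⟨fun h => h1 (hL h), h2, h3, L.hasFDerivAt.comp_hasDerivAt s h4, by simp [hfg, h5]⟩

/-- A differentiable curve is tangent at its end point to each subspace containing the velocity. -/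
theorem tendsto_infDist_div_norm_of_hasDerivWithinAt {γ : ℝ → E} {p v : E} (h0 : γ 0 = p)
    (hv : HasDerivWithinAt γ v (Set.Ici 0) 0) (hv0 : v ≠ 0) {S : Submodule ℝ E} (hS : v ∈ S) :
    Tendsto (fun s => Metric.infDist (γ s - p) (S : Set E) / ‖γ s - p‖) (𝓝[>] 0) (𝓝 0) := by
  have hg : Tendsto (fun s : ℝ => s⁻¹ • (γ s - p)) (𝓝[>] 0) (𝓝 v) := by
    have := hasDerivWithinAt_iff_tendsto_slope.1 hv
    rw [Set.Ici_sdiff_left] at this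
    simpa [slope_fun_def, h0] using this
  have hlim : Tendsto (fun s : ℝ => ‖s⁻¹ • (γ s - p) - v‖ / ‖s⁻¹ • (γ s - p)‖) (𝓝[>] 0) (𝓝 0) := by
    have := (hg.sub_const v).norm.div hg.norm (norm_ne_zero_iff.2 hv0)
    rw [sub_self, norm_zero, zero_div] at this
    exact this
  refine squeeze_zero' (Eventually.of_forall fun s =>
    div_nonneg Metric.infDist_nonneg (norm_nonneg _)) ?_ hlim
  filter_upwards [self_mem_nhdsWithin] with s hs
  have hs : 0 < s := hs
  have h1 : γ s - p = s • (s⁻¹ • (γ s - p)) := by rw [smul_inv_smul₀ hs.ne']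
  -- The competitor in `S` is `s • v`.
  have h2 : Metric.infDist (γ s - p) (S : Set E) ≤ s * ‖s⁻¹ • (γ s - p) - v‖ := by
    refine (Metric.infDist_le_dist_of_mem (S.smul_mem s hS)).trans_eq ?_
    rw [dist_eq_norm]
    nth_rw 1 [h1]
    rw [← smul_sub, norm_smul, Real.norm_of_nonneg hs.le]
  have h3 : ‖γ s - p‖ = s * ‖s⁻¹ • (γ s - p)‖ := by
    nth_rw 1 [h1]
    rw [norm_smul, Real.norm_of_nonneg hs.le]
  calc _ ≤ s * ‖s⁻¹ • (γ s - p) - v‖ / ‖γ s - p‖ := by gcongr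
    _ = _ := by rw [h3, mul_div_mul_left _ _ hs.ne']

/-- With `s = exp (-ξ)` the motion along the curve becomes `ξ' = -Φ(s)/s`, which is positive and at
most `C`. So `ξ` exists for all time and tends to infinity: the end point is approached but not
reached in finite time. -/
theorem HasEnteringCurve.exists_solution {f : E → E} {p v : E} (h : HasEnteringCurve f p v)
    (hv0 : v ≠ 0) {S : Submodule ℝ E} (hS : v ∈ S) :
    ∃ x : ℝ → E, IsIntegralCurveOn x (fun _ => f) (Set.Ici 0) ∧ TendsTangentially x atTop p S := by
  obtain ⟨γ, γ', Φ, r, C, hr, h0, hv, hΦ, h⟩ := h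
  -- The cap at `r` defines the velocity for every `ξ`. It is inactive for `t ≥ 0`, because `ξ`
  -- starts at `-log r` and increases.
  let m : ℝ → ℝ := fun ξ => min (Real.exp (-ξ)) r
  have hm : ∀ ξ, m ξ ∈ Set.Ioc 0 r := fun ξ => ⟨lt_min (Real.exp_pos _) hr, min_le_right _ _⟩
  have hmc : Continuous m := by fun_prop
  obtain ⟨x, hx0, hx, hxlim⟩ := exists_solution_tendsto_atTop (V := fun ξ => -Φ (m ξ) / m ξ)
    ((hΦ.comp_continuous hmc hm).neg.div hmc fun ξ => (hm ξ).1.ne')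
    (fun ξ => div_pos (neg_pos.2 (h _ (hm ξ)).2.1) (hm ξ).1) (C := C)
    (fun ξ => by
      rw [div_le_iff₀ (hm ξ).1]
      have := (h _ (hm ξ)).2.2.1
      linarith) (-Real.log r)
  have hxm : Monotone x := monotone_of_deriv_nonneg (fun t => (hx t).differentiableAt) fun t => by
    rw [(hx t).deriv]
    exact (div_pos (neg_pos.2 (h _ (hm _)).2.1) (hm _).1).le
  have hmx : ∀ t ∈ Set.Ici (0 : ℝ), m (x t) = Real.exp (-x t) := by
    intro t ht
    refine min_eq_left ?_
    have := hxm ht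
    rw [hx0] at this
    calc Real.exp (-x t) ≤ Real.exp (Real.log r) := Real.exp_le_exp.2 (by linarith)
      _ = r := Real.exp_log hr
  have hlim : Tendsto (fun t => m (x t)) atTop (𝓝[>] 0) := by
    refine tendsto_nhdsWithin_iff.2 ⟨?_, Eventually.of_forall fun t => (hm _).1⟩
    have h1 : Tendsto (fun t => Real.exp (-x t)) atTop (𝓝 0) :=
      Real.tendsto_exp_neg_atTop_nhds_zero.comp hxlim
    simpa [hr.le] using h1.min (tendsto_const_nhds (x := r))
  refine ⟨fun t => γ (m (x t)), fun t ht => ?_, fun t => (h _ (hm _)).1, ?_,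
    (tendsto_infDist_div_norm_of_hasDerivWithinAt h0 hv hv0 hS).comp hlim⟩
  · obtain ⟨-, -, -, h4, h5⟩ := h _ (hm (x t))
    have hd : HasDerivAt (fun t => Real.exp (-x t)) (Φ (m (x t))) t := by
      have := (hx t).fun_neg.exp
      rwa [← hmx t ht, neg_div, neg_neg, mul_div_cancel₀ _ (hm (x t)).1.ne'] at this
    have h6 : HasDerivAt γ (γ' (m (x t))) (Real.exp (-x t)) := hmx t ht ▸ h4
    have h7 := (h6.scomp t hd).hasDerivWithinAt (s := Set.Ici 0)
    rw [← h5] at h7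
    refine h7.congr (fun u hu => ?_) ?_
    · simp [hmx u hu]
    · simp [hmx t ht]
  · have h1 : Tendsto γ (𝓝[>] 0) (𝓝 p) := by
      rw [← h0]
      exact hv.continuousWithinAt.tendsto.mono_left (nhdsWithin_mono _ Set.Ioi_subset_Ici_self)
    exact h1.comp hlim

/-- An equilibrium with curves that enter in forward and in backward time, along eigenvectors of
the linearization with different eigenvalues, is a saddle. -/
theorem isSaddle_of_hasEnteringCurve {f : E → E} {f' : E →L[ℝ] E} {p v w : E} {c d : ℝ}
    (hp : f p = 0) (hf : HasFDerivAt f f' p) (hv0 : v ≠ 0) (hw0 : w ≠ 0) (hv : f' v = c • v)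
    (hw : f' w = d • w) (hcd : c ≠ d) (h₁ : HasEnteringCurve f p v)
    (h₂ : HasEnteringCurve (fun z => -f z) p w) : IsSaddle f p := by
  have hinv : ∀ {u : E} {a : ℝ}, f' u = a • u → ∀ z ∈ ℝ ∙ u, fderiv ℝ f p z ∈ ℝ ∙ u := by
    intro u a hu z hz
    obtain ⟨b, rfl⟩ := Submodule.mem_span_singleton.1 hz
    rw [hf.fderiv, map_smul, hu]
    exact Submodule.smul_mem _ _ (Submodule.smul_mem _ _ (Submodule.mem_span_singleton_self u))
  refine ⟨hp, hf.differentiableAt, ℝ ∙ v, ℝ ∙ w, hinv hv, hinv hw, ?_,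
    h₁.exists_solution hv0 (Submodule.mem_span_singleton_self v), ?_⟩
  · rw [Submodule.eq_bot_iff]
    rintro z ⟨hz₁, hz₂⟩
    obtain ⟨a, rfl⟩ := Submodule.mem_span_singleton.1 hz₁
    obtain ⟨b, hb⟩ := Submodule.mem_span_singleton.1 hz₂
    -- A common vector of the two lines satisfies the eigenvalue equation for both `c` and `d`,
    -- hence vanishes.
    have h1 : f' (a • v) = c • (a • v) := by rw [map_smul, hv, smul_comm]
    have h2 : f' (a • v) = d • (a • v) := by rw [← hb, map_smul, hw, smul_comm]
    have h3 : (c - d) • (a • v) = 0 := by rw [sub_smul, ← h1, ← h2, sub_self]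
    exact (smul_eq_zero.1 h3).resolve_left (sub_ne_zero.2 hcd)
  · obtain ⟨x, hx, hne, hlim, htan⟩ :=
      h₂.exists_solution hw0 (Submodule.mem_span_singleton_self w)
    refine ⟨fun t => x (-t), fun t ht => ?_, fun t => hne _, hlim.comp tendsto_neg_atBot_atTop,
      htan.comp tendsto_neg_atBot_atTop⟩
    have ht' : -t ∈ Set.Ici (0 : ℝ) := by simpa using ht
    have := (hx (-t) ht').scomp t (hasDerivAt_neg t).hasDerivWithinAt
      (s := Set.Iic 0) (fun u hu => by simpa using hu)
    simpa [Function.comp_def] using this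

/-- The orbit that emanates from `p` is arbitrarily close to `p` at very negative times `t`, yet
time `-t` later it is at `y 0`, whose distance from `p` is fixed and positive. That distance serves
as `ε`. -/
theorem IsSaddle.isUnstableEquilibrium {f : E → E} {p : E} (h : IsSaddle f p) :
    IsUnstableEquilibrium f p := by
  obtain ⟨hp, -, S, U, -, -, -, -, y, hy, hne, hlim, -⟩ := h
  refine ⟨hp, fun hst => ?_⟩
  obtain ⟨δ, hδ, hst⟩ := hst (dist (y 0) p) (dist_pos.2 (hne 0))
  obtain ⟨t, ht, ht0⟩ :=
    ((hlim.eventually (Metric.ball_mem_nhds p hδ)).and (eventually_le_atBot 0)).exists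
  refine lt_irrefl (dist (y 0) p) ?_
  have := hst (fun τ => y (τ + t)) (-t) (fun τ hτ => ?_) (by simpa using ht) (-t)
    ⟨neg_nonneg.2 ht0, le_rfl⟩
  · simp at this
  · have h1 := (hy (τ + t) (show τ + t ≤ 0 by linarith [hτ.2])).scomp τ
      ((hasDerivAt_id τ).add_const t).hasDerivWithinAt (s := Set.Icc 0 (-t))
      (fun u hu => show u + t ≤ 0 by linarith [hu.2])
    simpa [Function.comp_def] using h1

end EnteringCurves

/-! ### Planar equilibria with eigenvalues `-lam < 0` and `0` -/

theorem eventually_mul_lt (M : ℝ) {c : ℝ} (hc : 0 < c) : ∀ᶠ r in 𝓝[>] (0 : ℝ), M * r < c := by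
  have : Tendsto (fun r : ℝ => M * r) (𝓝[>] 0) (𝓝 0) := by
    have h : Continuous fun r : ℝ => M * r := by fun_prop
    simpa using h.continuousAt.tendsto.mono_left (nhdsWithin_le_nhds (a := (0 : ℝ)))
  exact this.eventually_lt_const hc

/-- The strong stable orbit of `x' = X x y`, `y' = Y x y`, with `X = -lam x - a y` to first order
and `Y` of order `x²`, as a graph over the `x`-axis. -/
theorem exists_strongStable_graph {X Y : ℝ → ℝ → ℝ} {lam a C ρ : ℝ} (hlam : 0 < lam) (ha : 0 < a)
    (hC : 0 < C) (hρ : 0 < ρ)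
    (hX1 : ∀ x y, |x| < ρ → |y| < ρ → ContDiffAt ℝ 1 (fun z : ℝ × ℝ => X z.1 z.2) (x, y))
    (hY1 : ∀ x y, |x| < ρ → |y| < ρ → ContDiffAt ℝ 1 (fun z : ℝ × ℝ => Y z.1 z.2) (x, y))
    (hX : ∀ x y, |x| < ρ → |y| < ρ → |X x y + lam * x + a * y| ≤ C * (x ^ 2 + y ^ 2))
    (hY : ∀ x y, |x| < ρ → |y| < ρ → x ≠ 0 → 0 < Y x y ∧ Y x y ≤ C * x ^ 2) :
    ∃ (g : ℝ → ℝ) (r K : ℝ), 0 < r ∧ ∀ x ∈ Set.Ioo 0 r, |x| < ρ ∧ |g x| < ρ ∧ X x (g x) < 0 ∧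
      |g x| ≤ K * x ^ 2 ∧ HasDerivAt g (Y x (g x) / X x (g x)) x := by
  -- Near the origin `-X ≥ lam x / 2`, so `Y / X ≥ -(2C/lam) x`; the barrier `-K x²` has the smaller
  -- slope `-2K x` once `K > C/lam`. The constant `M` collects the terms of size `x²` in `X ≤ -lam x
  -- + M x²`, and `M r < lam/2` absorbs them.
  set K := C / lam + 1 with hK
  have hK0 : 0 < K := by positivity
  set M := a * K + C * (1 + K ^ 2) with hM
  obtain ⟨r, ⟨⟨⟨h1, h2⟩, h3⟩, h4⟩, hr⟩ :=
    ((((eventually_mul_lt 1 one_pos).and (eventually_mul_lt 1 hρ)).and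
      (eventually_mul_lt K hρ)).and (eventually_mul_lt M (half_pos hlam))).and
      self_mem_nhdsWithin |>.exists
  have hr : 0 < r := hr
  rw [one_mul] at h1 h2
  have hreg : ∀ s ∈ Set.Ioc 0 r, ∀ y ∈ Set.Icc (-(K * s ^ 2)) 0,
      |s| < ρ ∧ |y| < ρ ∧ X s y ≤ -(lam / 2 * s) := by
    rintro s ⟨hs0, hsr⟩ y ⟨hy1, hy2⟩
    have e1 : |s| < ρ := by rw [abs_of_pos hs0]; linarith
    have hs2 : s ^ 2 ≤ s := by nlinarith
    have hyK : -y ≤ K * s ^ 2 := by linarith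
    have e2 : |y| < ρ := by
      rw [abs_of_nonpos hy2]
      nlinarith [mul_le_mul_of_nonneg_left hs2 hK0.le, mul_le_mul_of_nonneg_left hsr hK0.le]
    refine ⟨e1, e2, ?_⟩
    have h := (abs_le.1 (hX s y e1 e2)).2
    have hy3 : y ^ 2 ≤ K ^ 2 * s ^ 2 := by
      have e3 : -y ≤ K * s := hyK.trans (mul_le_mul_of_nonneg_left hs2 hK0.le)
      have e4 := mul_self_le_mul_self (neg_nonneg.2 hy2) e3
      linarith [e4, neg_mul_neg y y]
    have e5 : C * (s ^ 2 + y ^ 2) ≤ C * ((1 + K ^ 2) * s ^ 2) := by gcongr; linarith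
    have e6 : a * -y ≤ a * (K * s ^ 2) := by gcongr
    have e7 : M * s * s ≤ lam / 2 * s := by
      refine mul_le_mul_of_nonneg_right ?_ hs0.le
      have : M * s ≤ M * r := by gcongr
      linarith
    have e8 : M * s * s = a * (K * s ^ 2) + C * ((1 + K ^ 2) * s ^ 2) := by rw [hM]; ring
    linarith
  have hneg : ∀ s ∈ Set.Ioc 0 r, ∀ y ∈ Set.Icc (-(K * s ^ 2)) 0, X s y < 0 := fun s hs y hy =>
    (hreg s hs y hy).2.2.trans_lt (neg_neg_of_pos (mul_pos (half_pos hlam) hs.1))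
  have hle : ∀ s, -(K * s ^ 2) ≤ 0 := fun s => neg_nonpos.2 (by positivity)
  obtain ⟨g, hg⟩ := exists_solution_of_singular_endpoint (G := fun s y => Y s y / X s y)
    (α := fun s => -(K * s ^ 2)) (α' := fun s => -(K * (2 * s))) (β := fun _ => 0)
    (β' := fun _ => 0) hr (fun s => by simpa using ((hasDerivAt_pow 2 s).const_mul K).fun_neg)
    (fun s => hasDerivAt_const s 0) (fun s _ => hle s)
    (fun s hs y hy => (hY1 s y (hreg s hs y hy).1 (hreg s hs y hy).2.1).div
      (hX1 s y (hreg s hs y hy).1 (hreg s hs y hy).2.1) (hneg s hs y hy).ne)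
    (fun s hs => by
      have hy : -(K * s ^ 2) ∈ Set.Icc (-(K * s ^ 2)) 0 := ⟨le_rfl, hle s⟩
      obtain ⟨e1, e2, e3⟩ := hreg s hs _ hy
      rw [lt_div_iff_of_neg (hneg s hs _ hy)]
      have e4 := (hY s _ e1 e2 hs.1.ne').2
      have e5 : K * (2 * s) * (lam / 2 * s) ≤ K * (2 * s) * -X s (-(K * s ^ 2)) := by
        have := hs.1
        gcongr
        linarith
      have e6 : K * (2 * s) * (lam / 2 * s) = C * s ^ 2 + lam * s ^ 2 := by
        rw [hK]; field_simp
      have e7 : 0 < lam * s ^ 2 := mul_pos hlam (pow_pos hs.1 2)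
      linarith)
    (fun s hs => by
      have hy : (0 : ℝ) ∈ Set.Icc (-(K * s ^ 2)) 0 := ⟨hle s, le_rfl⟩
      obtain ⟨e1, e2, -⟩ := hreg s hs _ hy
      exact div_neg_of_pos_of_neg (hY s 0 e1 e2 hs.1.ne').1 (hneg s hs _ hy))
  refine ⟨g, r, K, hr, fun s hs => ?_⟩
  obtain ⟨hd, hm⟩ := hg s hs
  have hs' := Set.Ioo_subset_Ioc_self hs
  refine ⟨(hreg s hs' _ hm).1, (hreg s hs' _ hm).2.1, hneg s hs' _ hm, ?_, hd⟩
  rw [abs_of_nonpos hm.2]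
  linarith [hm.1]

/-- The center orbit over `y > 0` of `x' = X x y`, `y' = Y x y`, with `X = -lam x - a y` to first
order and `Y` of order `x²`, as a graph over the `y`-axis. -/
theorem exists_center_graph {X Y : ℝ → ℝ → ℝ} {lam a C ρ : ℝ} (hlam : 0 < lam) (ha : 0 < a)
    (hC : 0 < C) (hρ : 0 < ρ)
    (hX1 : ∀ x y, |x| < ρ → |y| < ρ → ContDiffAt ℝ 1 (fun z : ℝ × ℝ => X z.1 z.2) (x, y))
    (hY1 : ∀ x y, |x| < ρ → |y| < ρ → ContDiffAt ℝ 1 (fun z : ℝ × ℝ => Y z.1 z.2) (x, y))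
    (hX : ∀ x y, |x| < ρ → |y| < ρ → |X x y + lam * x + a * y| ≤ C * (x ^ 2 + y ^ 2))
    (hY : ∀ x y, |x| < ρ → |y| < ρ → x ≠ 0 → 0 < Y x y ∧ Y x y ≤ C * x ^ 2) :
    ∃ (h : ℝ → ℝ) (r K : ℝ), 0 < r ∧ ∀ y ∈ Set.Ioo 0 r, |h y| < ρ ∧ |y| < ρ ∧ 0 < Y (h y) y ∧
      |h y + a / lam * y| ≤ K * y ^ 2 ∧ HasDerivAt h (X (h y) y / Y (h y) y) y := by
  set m := a / lam with hm
  have hm0 : 0 < m := by positivity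
  have hma : lam * m = a := mul_div_cancel₀ a hlam.ne'
  -- In the region `|x| ≤ 2 m y`, so `c y²` bounds the error of `X` and `4 C m² y²` bounds `Y`. On
  -- the barriers the linear part of `X` equals `± lam K y²`; the choice of `K` beats `c y²` and
  -- also the contribution `m Y` of the slope `-m` on the upper barrier. The condition `K r < m`
  -- keeps `x < 0`, and thus `Y > 0`.
  set c := C * (4 * m ^ 2 + 1) with hc
  set K := (c + 4 * C * m ^ 3 + 1) / lam with hK
  have hK0 : 0 < K := by positivity
  have hKl : lam * K = c + 4 * C * m ^ 3 + 1 := mul_div_cancel₀ _ hlam.ne'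
  obtain ⟨r, ⟨⟨h1, h2⟩, h3⟩, hr⟩ :=
    (((eventually_mul_lt 1 hρ).and (eventually_mul_lt (2 * m) hρ)).and
      (eventually_mul_lt K hm0)).and self_mem_nhdsWithin |>.exists
  have hr : 0 < r := hr
  rw [one_mul] at h1
  have hreg : ∀ s ∈ Set.Ioc 0 r, ∀ x ∈ Set.Icc (-(m * s) - K * s ^ 2) (-(m * s) + K * s ^ 2),
      |x| < ρ ∧ |s| < ρ ∧ x < 0 ∧ |X x s + lam * x + a * s| ≤ c * s ^ 2 ∧
        0 < Y x s ∧ Y x s ≤ 4 * C * m ^ 2 * s ^ 2 := by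
    rintro s ⟨hs0, hsr⟩ x ⟨hx1, hx2⟩
    have hKs : K * s ^ 2 < m * s := by
      rw [sq, ← mul_assoc]
      refine mul_lt_mul_of_pos_right ?_ hs0
      have : K * s ≤ K * r := by gcongr
      linarith
    have hx0 : x < 0 := by linarith
    have hx3 : -x ≤ 2 * m * s := by linarith
    have e1 : |x| < ρ := by
      rw [abs_of_neg hx0]
      have : 2 * m * s ≤ 2 * m * r := by gcongr
      linarith
    have e2 : |s| < ρ := by rw [abs_of_pos hs0]; linarith
    have e3 : x ^ 2 ≤ 4 * m ^ 2 * s ^ 2 := by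
      have := mul_self_le_mul_self (neg_nonneg.2 hx0.le) hx3
      calc x ^ 2 = -x * -x := by ring
        _ ≤ _ := this
        _ = _ := by ring
    have hYx := hY x s e1 e2 hx0.ne
    refine ⟨e1, e2, hx0, (hX x s e1 e2).trans ?_, hYx.1, hYx.2.trans ?_⟩
    · rw [hc, mul_assoc]; gcongr; linarith
    · have : C * x ^ 2 ≤ C * (4 * m ^ 2 * s ^ 2) := by gcongr
      linarith
  have hle : ∀ s : ℝ, -(m * s) - K * s ^ 2 ≤ -(m * s) + K * s ^ 2 := fun s => by
    have : 0 ≤ K * s ^ 2 := by positivity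
    linarith
  have hlin : ∀ s, HasDerivAt (fun s => -(m * s)) (-m) s := fun s => by
    simpa using ((hasDerivAt_id s).const_mul m).fun_neg
  have hquad : ∀ s, HasDerivAt (fun s => K * s ^ 2) (K * (2 * s)) s := fun s => by
    simpa using (hasDerivAt_pow 2 s).const_mul K
  have hswap : ∀ {Z : ℝ → ℝ → ℝ} {s x : ℝ}, ContDiffAt ℝ 1 (fun z : ℝ × ℝ => Z z.1 z.2) (x, s) →
      ContDiffAt ℝ 1 (fun z : ℝ × ℝ => Z z.2 z.1) (s, x) := fun {Z s x} hZ =>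
    hZ.comp (f := fun z : ℝ × ℝ => (z.2, z.1)) (s, x) (contDiff_snd.prodMk contDiff_fst).contDiffAt
  obtain ⟨h, hh⟩ := exists_solution_of_singular_endpoint (G := fun s x => X x s / Y x s)
    (α := fun s => -(m * s) - K * s ^ 2) (β := fun s => -(m * s) + K * s ^ 2)
    hr (fun s => (hlin s).fun_sub (hquad s)) (fun s => (hlin s).fun_add (hquad s))
    (fun s _ => hle s)
    (fun s hs x hx => by
      obtain ⟨e1, e2, -, -, e3, -⟩ := hreg s hs x hx
      exact (hswap (hX1 x s e1 e2)).div (hswap (hY1 x s e1 e2)) e3.ne')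
    (fun s hs => by
      obtain ⟨-, -, -, e3, e4, e5⟩ := hreg s hs _ ⟨le_rfl, hle s⟩
      rw [lt_div_iff₀ e4]
      have e6 : (-m - K * (2 * s)) * Y (-(m * s) - K * s ^ 2) s ≤ 0 :=
        mul_nonpos_of_nonpos_of_nonneg (by have := hs.1; nlinarith) e4.le
      have e7 := (abs_le.1 e3).1
      have e8 : lam * (-(m * s) - K * s ^ 2) = -(a * s) - (c + 4 * C * m ^ 3 + 1) * s ^ 2 := by
        rw [← hKl, ← hma]; ring
      have e9 : 0 < (4 * C * m ^ 3 + 1) * s ^ 2 := mul_pos (by positivity) (pow_pos hs.1 2)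
      linarith)
    (fun s hs => by
      obtain ⟨-, -, -, e3, e4, e5⟩ := hreg s hs _ ⟨hle s, le_rfl⟩
      rw [div_lt_iff₀ e4]
      have e6 : 0 ≤ K * (2 * s) * Y (-(m * s) + K * s ^ 2) s := by
        have := hs.1
        positivity
      have e7 := (abs_le.1 e3).2
      have e8 : lam * (-(m * s) + K * s ^ 2) = -(a * s) + (c + 4 * C * m ^ 3 + 1) * s ^ 2 := by
        rw [← hKl, ← hma]; ring
      have e9 : m * Y (-(m * s) + K * s ^ 2) s ≤ m * (4 * C * m ^ 2 * s ^ 2) := by gcongr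
      have e10 : 0 < s ^ 2 := pow_pos hs.1 2
      linarith)
  refine ⟨h, r, K, hr, fun s hs => ?_⟩
  obtain ⟨hd, hmem⟩ := hh s hs
  obtain ⟨e1, e2, -, -, e3, -⟩ := hreg s (Set.Ioo_subset_Ioc_self hs) _ hmem
  refine ⟨e1, e2, e3, abs_le.2 ⟨?_, ?_⟩, hd⟩
  · linarith [hmem.1]
  · linarith [hmem.2]

/-- A function that is `C²` at a point agrees with its linearization up to a quadratic error. -/
theorem exists_quadratic_bound_of_contDiffAt {E F : Type*} [NormedAddCommGroup E] [NormedSpace ℝ E]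
    [NormedAddCommGroup F] [NormedSpace ℝ F] {f : E → F} {p : E} (hf : ContDiffAt ℝ 2 f p) :
    ∃ C > 0, ∀ᶠ z in 𝓝 p, ‖f z - f p - fderiv ℝ f p (z - p)‖ ≤ C * ‖z - p‖ ^ 2 := by
  obtain ⟨K, t, ht, hK⟩ := (hf.fderiv_right (m := 1) le_rfl).exists_lipschitzOnWith
  obtain ⟨ρ, hρ, hball⟩ := Metric.mem_nhds_iff.1
    (inter_mem ht ((hf.eventually (by simp)).mono fun z hz => hz.differentiableAt (by simp)))
  refine ⟨K + 1, by positivity, ?_⟩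
  filter_upwards [Metric.ball_mem_nhds p hρ] with z hz
  have hp : p ∈ t := mem_of_mem_nhds ht
  have hsub : Metric.closedBall p (dist z p) ⊆ Metric.ball p ρ := Metric.closedBall_subset_ball hz
  -- On the ball of radius `dist z p` the derivative differs from the one at `p` by at most `K *
  -- dist z p`; the mean value inequality supplies the second factor.
  have := (convex_closedBall p (dist z p)).norm_image_sub_le_of_norm_fderiv_le' (𝕜 := ℝ) (f := f)
    (φ := fderiv ℝ f p) (C := K * dist z p) (x := p) (y := z)
    (fun w hw => (hball (hsub hw)).2) (fun w hw => by
      rw [← dist_eq_norm]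
      refine (hK.dist_le_mul w (hball (hsub hw)).1 p hp).trans ?_
      gcongr
      exact hw) (Metric.mem_closedBall_self dist_nonneg) (Metric.mem_closedBall.2 le_rfl)
  refine this.trans ?_
  rw [dist_eq_norm]
  nlinarith [sq_nonneg ‖z - p‖]

/-- A function on `(0, r)` that agrees with `m x` up to a quadratic error extends differentiably
to `0`. -/
theorem exists_extension_hasDerivWithinAt {g : ℝ → ℝ} {r m K : ℝ} (hr : 0 < r)
    (hg : ∀ x ∈ Set.Ioo 0 r, |g x - m * x| ≤ K * x ^ 2) :
    ∃ k : ℝ → ℝ, k 0 = 0 ∧ HasDerivWithinAt k m (Set.Ici 0) 0 ∧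
      ∀ x ∈ Set.Ioo 0 r, k x = g x ∧ ∀ d, HasDerivAt g d x → HasDerivAt k d x := by
  have heq : ∀ x ∈ Set.Ioo 0 r, Function.update g 0 0 x = g x := fun x hx =>
    Function.update_of_ne hx.1.ne' _ _
  refine ⟨Function.update g 0 0, Function.update_self .., ?_, fun x hx => ⟨heq x hx, fun d hd => ?_⟩⟩
  · rw [← hasDerivWithinAt_Ioi_iff_Ici, hasDerivWithinAt_iff_tendsto_slope,
      Set.sdiff_singleton_eq_self Set.self_notMem_Ioi, tendsto_iff_norm_sub_tendsto_zero]
    have hlim : Tendsto (fun x : ℝ => K * x) (𝓝[>] 0) (𝓝 0) := by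
      have h : Continuous fun x : ℝ => K * x := by fun_prop
      simpa using h.continuousAt.tendsto.mono_left (nhdsWithin_le_nhds (a := (0 : ℝ)))
    refine squeeze_zero' (Eventually.of_forall fun x => norm_nonneg _) ?_ hlim
    filter_upwards [Ioo_mem_nhdsGT hr] with x hx
    have hx0 : x ≠ 0 := hx.1.ne'
    rw [slope_def_field, heq x hx, Function.update_self, sub_zero, sub_zero,
      show g x / x - m = (g x - m * x) / x by field_simp, norm_div, Real.norm_eq_abs,
      Real.norm_eq_abs, abs_of_pos hx.1, div_le_iff₀ hx.1]
    linarith [hg x hx]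
  · refine hd.congr_of_eventuallyEq ?_
    filter_upwards [Ioo_mem_nhds hx.1 hx.2] with y hy using heq y hy

section Reduction

variable {f : ℝ × ℝ × ℝ → ℝ × ℝ × ℝ} {X Y : ℝ → ℝ → ℝ} {q q' : ℝ → ℝ} {T₀ lam a C ρ : ℝ}

/-- The strong stable orbit of a vector field that leaves the surface `Q = q (T - T₀)` invariant. -/
theorem hasEnteringCurve_strongStable (hlam : 0 < lam) (ha : 0 < a) (hC : 0 < C) (hρ : 0 < ρ)
    (hX1 : ∀ x y, |x| < ρ → |y| < ρ → ContDiffAt ℝ 1 (fun z : ℝ × ℝ => X z.1 z.2) (x, y))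
    (hY1 : ∀ x y, |x| < ρ → |y| < ρ → ContDiffAt ℝ 1 (fun z : ℝ × ℝ => Y z.1 z.2) (x, y))
    (hX : ∀ x y, |x| < ρ → |y| < ρ → |X x y + lam * x + a * y| ≤ C * (x ^ 2 + y ^ 2))
    (hY : ∀ x y, |x| < ρ → |y| < ρ → x ≠ 0 → 0 < Y x y ∧ Y x y ≤ C * x ^ 2)
    (hq : ∀ y, |y| < ρ → HasDerivAt q (q' y) y)
    (hf : ∀ x y, |x| < ρ → |y| < ρ → f (x, T₀ + y, q y) = (X x y, Y x y, q' y * Y x y)) :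
    HasEnteringCurve f (0, T₀, q 0) (1, 0, 0) := by
  obtain ⟨g, r, K, hr, hg⟩ := exists_strongStable_graph hlam ha hC hρ hX1 hY1 hX hY
  obtain ⟨k, hk0, hk, hkg⟩ := exists_extension_hasDerivWithinAt (g := g) (m := 0) (K := K) hr
    (fun x hx => by simpa using (hg x hx).2.2.2.1)
  have hsub : ∀ s ∈ Set.Ioc 0 (r / 2), s ∈ Set.Ioo 0 r := fun s hs =>
    ⟨hs.1, hs.2.trans_lt (half_lt_self hr)⟩
  have hg' : ∀ s ∈ Set.Ioc 0 (r / 2), |s| < ρ ∧ |k s| < ρ ∧ X s (k s) < 0 ∧ |k s| ≤ K * s ^ 2 ∧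
      HasDerivAt k (Y s (k s) / X s (k s)) s := by
    intro s hs
    obtain ⟨h1, h2, h3, h4, h5⟩ := hg s (hsub s hs)
    obtain ⟨e1, e2⟩ := hkg s (hsub s hs)
    rw [e1]
    exact ⟨h1, h2, h3, h4, e2 _ h5⟩
  have h0 : |(0 : ℝ)| < ρ := by simpa using hρ
  -- The parameter is `x` itself, so its speed is `X`. The speed bound comes from `|y| ≤ K s²` and
  -- `s ≤ r`; halving `r` passes from the open interval to a half-closed one.
  refine ⟨fun s => (s, T₀ + k s, q (k s)),
    fun s => (1, Y s (k s) / X s (k s), q' (k s) * (Y s (k s) / X s (k s))),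
    fun s => X s (k s), r / 2, lam + a * K * r + C * (r + K ^ 2 * r ^ 3), half_pos hr,
    by simp [hk0], ?_, fun s hs => ?_, fun s hs => ?_⟩
  · have hqk : HasDerivWithinAt (fun s => q (k s)) 0 (Set.Ici 0) 0 := by
      have : HasDerivAt q (q' 0) (k 0) := by rw [hk0]; exact hq 0 h0
      simpa [Function.comp_def] using this.comp_hasDerivWithinAt (0 : ℝ) hk
    exact (hasDerivWithinAt_id _ _).prodMk ((hk.const_add T₀).prodMk hqk)
  · obtain ⟨h1, h2, -, -, h5⟩ := hg' s hs
    exact ((hX1 s (k s) h1 h2).continuousAt.comp (f := fun s => (s, k s))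
      (continuousAt_id.prodMk h5.continuousAt)).continuousWithinAt
  · obtain ⟨h1, h2, h3, h4, h5⟩ := hg' s hs
    have hsr := (hsub s hs).2.le
    have hs0 := hs.1
    have hK : 0 ≤ K := by
      by_contra! hK
      have := (abs_nonneg _).trans h4
      nlinarith [pow_pos hs0 2]
    refine ⟨fun h => hs0.ne' (congrArg Prod.fst h), h3, ?_, ?_, ?_⟩
    · have e1 := (abs_le.1 (hX s _ h1 h2)).1
      have e2 : a * k s ≤ a * (K * (r * s)) := by
        refine mul_le_mul_of_nonneg_left (((le_abs_self _).trans h4).trans ?_) ha.le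
        rw [sq]; gcongr
      have e3 : k s ^ 2 ≤ K ^ 2 * r ^ 3 * s := by
        calc k s ^ 2 = |k s| ^ 2 := (sq_abs _).symm
          _ ≤ (K * s ^ 2) ^ 2 := by gcongr
          _ = K ^ 2 * s ^ 3 * s := by ring
          _ ≤ _ := by gcongr
      have e4 : C * (s ^ 2 + k s ^ 2) ≤ C * (r * s + K ^ 2 * r ^ 3 * s) := by
        refine mul_le_mul_of_nonneg_left (add_le_add ?_ e3) hC.le
        rw [sq]; gcongr
      linarith
    · exact (hasDerivAt_id s).prodMk ((h5.const_add T₀).prodMk ((hq _ h2).comp s h5))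
    · have := h3.ne
      rw [hf s _ h1 h2, Prod.smul_mk, Prod.smul_mk]
      simp only [smul_eq_mul, Prod.mk.injEq]
      refine ⟨by ring, ?_, ?_⟩ <;> field_simp

/-- The center orbit of a vector field that leaves the surface `Q = q (T - T₀)` invariant, in
backward time. -/
theorem hasEnteringCurve_center (hlam : 0 < lam) (ha : 0 < a) (hC : 0 < C) (hρ : 0 < ρ)
    (hX1 : ∀ x y, |x| < ρ → |y| < ρ → ContDiffAt ℝ 1 (fun z : ℝ × ℝ => X z.1 z.2) (x, y))
    (hY1 : ∀ x y, |x| < ρ → |y| < ρ → ContDiffAt ℝ 1 (fun z : ℝ × ℝ => Y z.1 z.2) (x, y))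
    (hX : ∀ x y, |x| < ρ → |y| < ρ → |X x y + lam * x + a * y| ≤ C * (x ^ 2 + y ^ 2))
    (hY : ∀ x y, |x| < ρ → |y| < ρ → x ≠ 0 → 0 < Y x y ∧ Y x y ≤ C * x ^ 2)
    (hY0 : ∀ y, |y| < ρ → Y 0 y = 0)
    (hq : ∀ y, |y| < ρ → HasDerivAt q (q' y) y)
    (hf : ∀ x y, |x| < ρ → |y| < ρ → f (x, T₀ + y, q y) = (X x y, Y x y, q' y * Y x y)) :
    HasEnteringCurve (fun z => -f z) (0, T₀, q 0) (-(a / lam), 1, q' 0) := by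
  obtain ⟨g, r, K, hr, hg⟩ := exists_center_graph hlam ha hC hρ hX1 hY1 hX hY
  obtain ⟨k, hk0, hk, hkg⟩ := exists_extension_hasDerivWithinAt (g := g) (m := -(a / lam)) (K := K)
    hr (fun x hx => by simpa using (hg x hx).2.2.2.1)
  have hsub : ∀ s ∈ Set.Ioc 0 (r / 2), s ∈ Set.Ioo 0 r := fun s hs =>
    ⟨hs.1, hs.2.trans_lt (half_lt_self hr)⟩
  have hg' : ∀ s ∈ Set.Ioc 0 (r / 2), |k s| < ρ ∧ |s| < ρ ∧ 0 < Y (k s) s ∧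
      |k s + a / lam * s| ≤ K * s ^ 2 ∧ HasDerivAt k (X (k s) s / Y (k s) s) s := by
    intro s hs
    obtain ⟨h1, h2, h3, h4, h5⟩ := hg s (hsub s hs)
    obtain ⟨e1, e2⟩ := hkg s (hsub s hs)
    rw [e1]
    exact ⟨h1, h2, h3, h4, e2 _ h5⟩
  have h0 : |(0 : ℝ)| < ρ := by simpa using hρ
  -- Here the parameter is `y`, and its speed in reversed time is `-Y`. As `|x| ≤ (a/lam + K r) s`,
  -- the bound `Y ≤ C x²` is even quadratic in `s`.
  refine ⟨fun s => (k s, T₀ + s, q s), fun s => (X (k s) s / Y (k s) s, 1, q' s),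
    fun s => -Y (k s) s, r / 2, C * (a / lam + K * r) ^ 2 * r, half_pos hr,
    by simp [hk0], ?_, fun s hs => ?_, fun s hs => ?_⟩
  · exact hk.prodMk (((hasDerivWithinAt_id _ _).const_add T₀).prodMk (hq 0 h0).hasDerivWithinAt)
  · obtain ⟨h1, h2, -, -, h5⟩ := hg' s hs
    exact ((hY1 (k s) s h1 h2).continuousAt.comp (f := fun s => (k s, s))
      (h5.continuousAt.prodMk continuousAt_id)).neg.continuousWithinAt
  · obtain ⟨h1, h2, h3, h4, h5⟩ := hg' s hs
    have hsr := (hsub s hs).2.le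
    have hs0 := hs.1
    have hK : 0 ≤ K := by
      by_contra! hK
      have := (abs_nonneg _).trans h4
      nlinarith [pow_pos hs0 2]
    have hks : k s ≠ 0 := fun h => h3.ne' (by rw [h]; exact hY0 s h2)
    refine ⟨fun h => hks (congrArg Prod.fst h), neg_neg_of_pos h3, ?_, ?_, ?_⟩
    · refine neg_le_neg ((hY _ s h1 h2 hks).2.trans ?_)
      have e1 : |k s| ≤ (a / lam + K * r) * s := by
        have e2 : |k s| ≤ |k s + a / lam * s| + |a / lam * s| := by
          simpa using abs_sub (k s + a / lam * s) (a / lam * s)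
        have e3 : |a / lam * s| = a / lam * s := abs_of_pos (by positivity)
        have e4 : K * s ^ 2 ≤ K * (r * s) := by rw [sq]; gcongr
        linarith
      calc C * k s ^ 2 = C * |k s| ^ 2 := by rw [sq_abs]
        _ ≤ C * ((a / lam + K * r) * s) ^ 2 := by gcongr
        _ = C * (a / lam + K * r) ^ 2 * s * s := by ring
        _ ≤ _ := by gcongr
    · exact h5.prodMk (((hasDerivAt_id s).const_add T₀).prodMk (hq s h2))
    · have := h3.ne'
      dsimp only
      rw [hf _ s h1 h2, Prod.smul_mk, Prod.smul_mk, Prod.neg_mk, Prod.neg_mk]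
      simp only [smul_eq_mul, Prod.mk.injEq]
      refine ⟨by field_simp, by ring, by ring⟩

end Reduction

/-! ### The E-model field near the line of equilibria -/

/-- The term `k = 0` is `1`. So the radicand of `eModelF` stays away from the singularity of the
square root. -/
theorem one_le_sum_cos_pow {n : ℕ} (hn : 1 ≤ n) (θ : ℝ) :
    1 ≤ ∑ k ∈ Finset.range n, Real.cos θ ^ (2 * k) := by
  have h : ∀ k ∈ Finset.range n, 0 ≤ Real.cos θ ^ (2 * k) := fun k _ => by
    rw [pow_mul]; positivity
  simpa using Finset.single_le_sum h (Finset.mem_range.2 hn)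

theorem contDiff_eModelF {n : ℕ} (hn : 1 ≤ n) : ContDiff ℝ 2 (eModelF n) :=
  ContDiff.sqrt (ContDiff.sum fun _ _ => Real.contDiff_cos.pow _)
    fun θ => (one_pos.trans_le (one_le_sum_cos_pow hn θ)).ne'

theorem eModelF_zero (n : ℕ) : eModelF n 0 = Real.sqrt n := by simp [eModelF]

theorem contDiff_eModelField {n : ℕ} (hn : 1 ≤ n) (μ : ℝ) : ContDiff ℝ 2 (eModelField n μ) := by
  have hF : ContDiff ℝ 2 fun z : ℝ × ℝ × ℝ => eModelF n z.1 := (contDiff_eModelF hn).comp contDiff_fst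
  unfold eModelField
  fun_prop

theorem eModelField_zero_half (n : ℕ) (μ Q : ℝ) : eModelField n μ (0, 1 / 2, Q) = 0 := by
  simp [eModelField]
  norm_num

/-- The linearization of the field at the equilibrium `(0, 1 / 2, Q)`. -/
def eModelLinearization (n : ℕ) (μ Q : ℝ) : ℝ × ℝ × ℝ →L[ℝ] ℝ × ℝ × ℝ :=
  (-(3 * Q / 2) • ContinuousLinearMap.fst ℝ ℝ (ℝ × ℝ) -
    (12 * μ / Real.sqrt n) •
      (ContinuousLinearMap.fst ℝ ℝ ℝ).comp (ContinuousLinearMap.snd ℝ ℝ (ℝ × ℝ))).prod 0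

theorem eModelLinearization_apply (n : ℕ) (μ Q : ℝ) (v : ℝ × ℝ × ℝ) :
    eModelLinearization n μ Q v = (-(3 * Q / 2) * v.1 - 12 * μ / Real.sqrt n * v.2.1, 0, 0) := rfl

theorem hasDerivAt_one_sub_cos_pow (n : ℕ) :
    HasDerivAt (fun θ : ℝ => 1 - Real.cos θ ^ (2 * n)) 0 0 := by
  simpa using ((Real.hasDerivAt_cos 0).fun_pow (2 * n)).const_sub 1

/-- In each product one factor vanishes at the equilibrium, so its cofactor enters only through its
value and need merely be differentiable. The factor `1 - cos²ⁿ θ` vanishes together with its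
derivative, which kills the `T` and `Q` rows. -/
theorem hasFDerivAt_eModelField {n : ℕ} (hn : 1 ≤ n) (μ Q : ℝ) :
    HasFDerivAt (eModelField n μ) (eModelLinearization n μ Q) (0, 1 / 2, Q) := by
  have hn0 : (n : ℝ) ≠ 0 := by exact_mod_cast (by omega : n ≠ 0)
  have hsq : Real.sqrt n * Real.sqrt n = n := Real.mul_self_sqrt n.cast_nonneg
  have hs0 : Real.sqrt n ≠ 0 := fun h => hn0 (by rw [← hsq, h, zero_mul])
  set p : ℝ × ℝ × ℝ := (0, 1 / 2, Q) with hp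
  have h1 : HasFDerivAt (fun z : ℝ × ℝ × ℝ => z.1) (ContinuousLinearMap.fst ℝ ℝ (ℝ × ℝ)) p :=
    hasFDerivAt_fst
  have h2 : HasFDerivAt (fun z : ℝ × ℝ × ℝ => z.2.1) ((ContinuousLinearMap.fst ℝ ℝ ℝ).comp
      (ContinuousLinearMap.snd ℝ ℝ (ℝ × ℝ))) p :=
    ((ContinuousLinearMap.fst ℝ ℝ ℝ).comp (ContinuousLinearMap.snd ℝ ℝ (ℝ × ℝ))).hasFDerivAt
  have h3 : HasFDerivAt (fun z : ℝ × ℝ × ℝ => z.2.2) ((ContinuousLinearMap.snd ℝ ℝ ℝ).comp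
      (ContinuousLinearMap.snd ℝ ℝ (ℝ × ℝ))) p :=
    ((ContinuousLinearMap.snd ℝ ℝ ℝ).comp (ContinuousLinearMap.snd ℝ ℝ (ℝ × ℝ))).hasFDerivAt
  have hF : HasFDerivAt (fun z : ℝ × ℝ × ℝ => eModelF n z.1)
      (fderiv ℝ (fun z : ℝ × ℝ × ℝ => eModelF n z.1) p) p :=
    DifferentiableAt.hasFDerivAt (((contDiff_eModelF hn).differentiable (by simp)).comp
      differentiable_fst p)
  have hw : HasFDerivAt (fun z : ℝ × ℝ × ℝ => 1 - Real.cos z.1 ^ (2 * n))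
      (0 : ℝ × ℝ × ℝ →L[ℝ] ℝ) p := by
    simpa [Function.comp_def] using (hasDerivAt_one_sub_cos_pow n).comp_hasFDerivAt p h1
  have hw0 : 1 - Real.cos p.1 ^ (2 * n) = 0 := by simp [hp]
  have hA : HasFDerivAt (fun z : ℝ × ℝ × ℝ => (z.2.1 - 1) * Real.cos z.1 + z.2.1)
      ((2 : ℝ) • (ContinuousLinearMap.fst ℝ ℝ ℝ).comp (ContinuousLinearMap.snd ℝ ℝ (ℝ × ℝ))) p := by
    refine (((h2.sub_const 1).mul h1.cos).add h2).congr_fderiv ?_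
    ext <;> simp [hp]
    norm_num
  have hS : HasFDerivAt (fun z : ℝ × ℝ × ℝ => Real.sin (2 * z.1))
      ((2 : ℝ) • ContinuousLinearMap.fst ℝ ℝ (ℝ × ℝ)) p := by
    refine ((h1.const_mul 2).sin).congr_fderiv ?_
    ext <;> simp [hp]
  have hG : HasFDerivAt (fun z : ℝ × ℝ × ℝ => 3 * z.2.2 * (z.2.1 - 1) * eModelF n z.1 ^ 2)
      (fderiv ℝ (fun z : ℝ × ℝ × ℝ => 3 * z.2.2 * (z.2.1 - 1) * eModelF n z.1 ^ 2) p) p :=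
    DifferentiableAt.hasFDerivAt
      (((h3.differentiableAt.const_mul 3).mul (h2.differentiableAt.sub_const 1)).mul
        (hF.differentiableAt.pow 2))
  have hH : HasFDerivAt (fun z : ℝ × ℝ × ℝ => 3 * z.2.2 * (z.2.1 - 1) ^ 2 * z.2.1)
      (fderiv ℝ (fun z : ℝ × ℝ × ℝ => 3 * z.2.2 * (z.2.1 - 1) ^ 2 * z.2.1) p) p :=
    DifferentiableAt.hasFDerivAt (by fun_prop)
  have hJ : HasFDerivAt (fun z : ℝ × ℝ × ℝ => -3 * (z.2.2 ^ 2 - 1) * (z.2.1 - 1))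
      (fderiv ℝ (fun z : ℝ × ℝ × ℝ => -3 * (z.2.2 ^ 2 - 1) * (z.2.1 - 1)) p) p :=
    DifferentiableAt.hasFDerivAt (by fun_prop)
  refine HasFDerivAt.prodMk (𝕜 := ℝ)
    (f₁ := fun z : ℝ × ℝ × ℝ => -(6 * μ * eModelF n z.1 * ((z.2.1 - 1) * Real.cos z.1 + z.2.1)) / n
      + 3 * z.2.2 * (z.2.1 - 1) * eModelF n z.1 ^ 2 * Real.sin (2 * z.1) / (2 * n))
    (f₂ := fun z : ℝ × ℝ × ℝ => (3 * z.2.2 * (z.2.1 - 1) ^ 2 * z.2.1 * (1 - Real.cos z.1 ^ (2 * n)) / n,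
      -3 * (z.2.2 ^ 2 - 1) * (z.2.1 - 1) * (1 - Real.cos z.1 ^ (2 * n)))) ?_ ?_
  · simp only [div_eq_mul_inv]
    refine (((hF.const_mul (6 * μ)).mul hA).neg.mul_const ((n : ℝ)⁻¹)
      |>.add ((hG.mul hS).mul_const ((2 * n : ℝ)⁻¹))).congr_fderiv ?_
    have hAp : (p.2.1 - 1) * Real.cos p.1 + p.2.1 = 0 := by simp [hp]; norm_num
    have hSp : Real.sin (2 * p.1) = 0 := by simp [hp]
    have hFp : eModelF n p.1 = Real.sqrt n := eModelF_zero n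
    have hGp : 3 * p.2.2 * (p.2.1 - 1) * Real.sqrt n ^ 2 = -(3 * Q / 2) * n := by
      rw [Real.sq_sqrt n.cast_nonneg]; simp only [hp]; ring
    simp only [hAp, hSp, hFp, hGp, zero_smul, add_zero]
    ext
    · simp
      field_simp
    · simp
      field_simp
      rw [Real.sq_sqrt n.cast_nonneg]
      ring
    · simp
  · refine ((((hH.mul hw).mul_const ((n : ℝ)⁻¹)).congr_fderiv ?_).prodMk
      ((hJ.mul hw).congr_fderiv ?_)).congr_fderiv (f' := (0 : ℝ × ℝ × ℝ →L[ℝ] ℝ).prod 0) rfl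
    · simp [hw0]
    · simp [hw0]

/-- Reversing the signs of `θ`, `Q` and of time preserves the system. -/
def eModelReflection : ℝ × ℝ × ℝ →L[ℝ] ℝ × ℝ × ℝ :=
  (-ContinuousLinearMap.fst ℝ ℝ (ℝ × ℝ)).prod
    (((ContinuousLinearMap.fst ℝ ℝ ℝ).prod (-ContinuousLinearMap.snd ℝ ℝ ℝ)).comp
      (ContinuousLinearMap.snd ℝ ℝ (ℝ × ℝ)))

theorem eModelReflection_apply (z : ℝ × ℝ × ℝ) : eModelReflection z = (-z.1, z.2.1, -z.2.2) := rfl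

theorem eModelReflection_injective : Function.Injective eModelReflection := fun z w h => by
  simpa [eModelReflection_apply, Prod.ext_iff] using h

/-- `eModelF` and `cos` are even, and `Q sin 2θ` is unchanged when both signs flip; only the `T`
component is odd in `Q`. -/
theorem eModelField_reflection (n : ℕ) (μ : ℝ) (z : ℝ × ℝ × ℝ) :
    eModelField n μ (eModelReflection z) = -eModelReflection (eModelField n μ z) := by
  obtain ⟨θ, T, Q⟩ := z
  have hF : eModelF n (-θ) = eModelF n θ := by simp [eModelF]
  simp only [eModelReflection_apply, eModelField, hF, Real.cos_neg, mul_neg, Real.sin_neg,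
    Prod.neg_mk, Prod.mk.injEq]
  refine ⟨by ring, by ring, by ring⟩

/-! ### The invariant surfaces -/

/-- The surface `Q = eModelLeaf n Q₀ (T - 1 / 2)` is invariant and contains `(θ, 1 / 2, Q₀)`. -/
def eModelLeaf (n : ℕ) (Q₀ u : ℝ) : ℝ :=
  Real.sqrt (1 + (Q₀ ^ 2 - 1) * ((1 / 2 + u) / (1 / 2 - u)) ^ (2 * n))

/-- The derivative of `eModelLeaf`. -/
def eModelLeafDeriv (n : ℕ) (Q₀ u : ℝ) : ℝ :=
  n * (eModelLeaf n Q₀ u ^ 2 - 1) / (eModelLeaf n Q₀ u * (1 / 2 + u) * (1 / 2 - u))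

theorem eModelLeaf_zero (n : ℕ) {Q₀ : ℝ} (hQ : 0 < Q₀) : eModelLeaf n Q₀ 0 = Q₀ := by
  simp [eModelLeaf, hQ.le]

theorem contDiffAt_eModelLeaf {n : ℕ} {Q₀ u : ℝ} (hu : |u| < 1 / 2) (hq : 0 < eModelLeaf n Q₀ u) :
    ContDiffAt ℝ 2 (eModelLeaf n Q₀) u := by
  have h1 : (1 / 2 : ℝ) - u ≠ 0 := by linarith [(abs_lt.1 hu).2]
  refine ContDiffAt.sqrt ?_ (Real.sqrt_pos.1 hq).ne'
  exact contDiffAt_const.add (contDiffAt_const.mul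
    (((contDiffAt_const.add contDiffAt_id).div (contDiffAt_const.sub contDiffAt_id) h1).pow _))

/-- Logarithmic differentiation of `q² - 1 = (Q₀² - 1) (A/B)²ⁿ`, with `A = 1/2 + u` and `B = 1/2 -
u`: since `A + B = 1`, the quotient `A/B` has logarithmic derivative `1/(A B)`. -/
theorem hasDerivAt_eModelLeaf {n : ℕ} (hn : 1 ≤ n) {Q₀ u : ℝ} (hu : |u| < 1 / 2)
    (hq : 0 < eModelLeaf n Q₀ u) : HasDerivAt (eModelLeaf n Q₀) (eModelLeafDeriv n Q₀ u) u := by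
  have h1 : 0 < (1 / 2 : ℝ) - u := by linarith [(abs_lt.1 hu).2]
  have h2 : 0 < (1 / 2 : ℝ) + u := by linarith [(abs_lt.1 hu).1]
  have hpos := Real.sqrt_pos.1 hq
  have hsq : eModelLeaf n Q₀ u ^ 2 = 1 + (Q₀ ^ 2 - 1) * ((1 / 2 + u) / (1 / 2 - u)) ^ (2 * n) :=
    Real.sq_sqrt hpos.le
  have hd := (((((hasDerivAt_id u).const_add (1 / 2)).fun_div ((hasDerivAt_id u).const_sub (1 / 2))
    h1.ne').fun_pow (2 * n)).const_mul (Q₀ ^ 2 - 1)).const_add 1 |>.sqrt hpos.ne'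
  refine hd.congr_deriv ?_
  -- Avoids the truncated exponent `2 * n - 1`.
  obtain ⟨m, hm⟩ : ∃ m, 2 * n = m + 1 := ⟨2 * n - 1, by omega⟩
  have hnm : (2 * n : ℝ) = m + 1 := by exact_mod_cast hm
  have hn' : (n : ℝ) = (m + 1) / 2 := by linarith
  change _ / (2 * eModelLeaf n Q₀ u) = _
  rw [eModelLeafDeriv, hsq, hm, hn']
  have hone : 1 * (1 / 2 - u) - (1 / 2 + u) * -1 = 1 := by ring
  simp only [id, hone, add_sub_cancel_left, add_tsub_cancel_right, Nat.cast_add, Nat.cast_one,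
    pow_succ _ m]
  generalize 1 / 2 + u = A at h2 ⊢
  generalize 1 / 2 - u = B at h1 ⊢
  generalize (A / B) ^ m = D
  field_simp

/-- Bernoulli's inequality for `(1 - sin² θ)ⁿ`, then `|sin θ| ≤ |θ|`. -/
theorem one_sub_cos_pow_le (n : ℕ) (θ : ℝ) : 1 - Real.cos θ ^ (2 * n) ≤ n * θ ^ 2 := by
  have h1 := one_add_mul_le_pow (a := Real.cos θ ^ 2 - 1) (by nlinarith [sq_nonneg (Real.cos θ)]) n
  rw [add_sub_cancel, ← pow_mul] at h1
  have h2 : Real.sin θ ^ 2 ≤ θ ^ 2 := sq_le_sq.2 Real.abs_sin_le_abs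
  have h3 : (n : ℝ) * (1 - Real.cos θ ^ 2) ≤ n * θ ^ 2 := by
    refine mul_le_mul_of_nonneg_left ?_ n.cast_nonneg
    linarith [Real.sin_sq_add_cos_sq θ]
  linarith

theorem one_sub_cos_pow_pos {n : ℕ} (hn : 1 ≤ n) {θ : ℝ} (h0 : θ ≠ 0) (hθ : |θ| < Real.pi) :
    0 < 1 - Real.cos θ ^ (2 * n) := by
  have h1 : Real.sin θ ≠ 0 := fun h =>
    h0 ((Real.sin_eq_zero_iff_of_lt_of_lt (abs_lt.1 hθ).1 (abs_lt.1 hθ).2).1 h)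
  have h2 : Real.cos θ ^ 2 < 1 := by
    have := pow_pos (abs_pos.2 h1) 2
    rw [sq_abs] at this
    linarith [Real.sin_sq_add_cos_sq θ]
  rw [pow_mul]
  exact sub_pos.2 (pow_lt_one₀ (sq_nonneg _) h2 (by omega))

/-- The two orbits that end at the equilibrium `(0, 1 / 2, Q)` with `Q > 0`, one of them in forward
and the other in backward time. -/
theorem hasEnteringCurve_eModelField {n : ℕ} (hn : 1 ≤ n) {μ : ℝ} (hμ : 0 < μ) {Q : ℝ}
    (hQ : 0 < Q) :
    HasEnteringCurve (eModelField n μ) (0, 1 / 2, Q) (1, 0, 0) ∧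
      HasEnteringCurve (fun z => -eModelField n μ z) (0, 1 / 2, Q)
        (-(12 * μ / Real.sqrt n / (3 * Q / 2)), 1, eModelLeafDeriv n Q 0) := by
  have hn0 : (0 : ℝ) < n := by exact_mod_cast hn
  set q := eModelLeaf n Q with hq
  have hq0 : q 0 = Q := eModelLeaf_zero n hQ
  have hqpos : 0 < q 0 := hq0.symm ▸ hQ
  -- `Γ` parametrizes the invariant surface, `Z` is the field along it, and `P` is the cofactor of
  -- `1 - cos²ⁿ θ` in the `T` equation.
  let Γ : ℝ × ℝ → ℝ × ℝ × ℝ := fun z => (z.1, 1 / 2 + z.2, q z.2)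
  let Z : ℝ × ℝ → ℝ × ℝ × ℝ := fun z => eModelField n μ (Γ z)
  let P : ℝ → ℝ := fun u => 3 * q u * (1 / 2 + u - 1) ^ 2 * (1 / 2 + u) / n
  have hΓ : ∀ z : ℝ × ℝ, |z.2| < 1 / 2 → 0 < q z.2 → ContDiffAt ℝ 2 Γ z := fun z h1 h2 =>
    contDiffAt_fst.prodMk ((contDiffAt_const.add contDiffAt_snd).prodMk
      ((contDiffAt_eModelLeaf h1 h2).comp z contDiffAt_snd))
  have hZ : ∀ z : ℝ × ℝ, |z.2| < 1 / 2 → 0 < q z.2 → ContDiffAt ℝ 2 Z z := fun z h1 h2 =>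
    (contDiff_eModelField hn μ).contDiffAt.comp z (hΓ z h1 h2)
  have hqc : ContinuousAt q 0 := (contDiffAt_eModelLeaf (by simp) hqpos).continuousAt
  have hPc : ContinuousAt P 0 := by fun_prop
  have hP0 : 0 < P 0 := by
    simp only [P, hq0]
    have : 0 < 3 * Q * (1 / 2 + 0 - 1) ^ 2 * (1 / 2 + 0) := by
      norm_num; linarith
    positivity
  have h00 : ContDiffAt ℝ 2 Z 0 := hZ 0 (by simp) (by simpa [hq0] using hQ)
  have hΓ0 : Γ 0 = (0, 1 / 2, Q) := by simp [Γ, hq0]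
  have hd : HasFDerivAt (fun z => (Z z).1) (-(3 * Q / 2) • ContinuousLinearMap.fst ℝ ℝ ℝ -
      (12 * μ / Real.sqrt n) • ContinuousLinearMap.snd ℝ ℝ ℝ) 0 := by
    have h1 : HasFDerivAt Γ ((ContinuousLinearMap.fst ℝ ℝ ℝ).prod
        ((ContinuousLinearMap.snd ℝ ℝ ℝ).prod
          (eModelLeafDeriv n Q 0 • ContinuousLinearMap.snd ℝ ℝ ℝ))) 0 := by
      have h2 : HasDerivAt q (eModelLeafDeriv n Q 0) (0 : ℝ × ℝ).2 :=
        hasDerivAt_eModelLeaf hn (by simp) hqpos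
      exact hasFDerivAt_fst.prodMk ((hasFDerivAt_snd.const_add (1 / 2 : ℝ)).prodMk
        (h2.comp_hasFDerivAt (0 : ℝ × ℝ) hasFDerivAt_snd))
    have h3 := hasFDerivAt_eModelField hn μ Q
    rw [← hΓ0] at h3
    refine (h3.comp (0 : ℝ × ℝ) h1).fst.congr_fderiv ?_
    ext <;> simp [eModelLinearization_apply]
  obtain ⟨C, hC, hquad⟩ := exists_quadratic_bound_of_contDiffAt h00.fst
  -- The bound `π` makes `θ = 0` the only zero of `1 - cos²ⁿ θ`; the bound `1/2` and `0 < q` keep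
  -- the surface smooth.
  have hev : ∀ᶠ z : ℝ × ℝ in 𝓝 0, (|z.1| < Real.pi ∧ |z.2| < 1 / 2) ∧ (0 < q z.2 ∧
      0 < P z.2 ∧ P z.2 < P 0 + 1) ∧ |(Z z).1 + 3 * Q / 2 * z.1 + 12 * μ / Real.sqrt n * z.2| ≤
        C * (z.1 ^ 2 + z.2 ^ 2) := by
    have e1 : Tendsto (fun z : ℝ × ℝ => z.1) (𝓝 0) (𝓝 0) := continuous_fst.tendsto 0
    have e2 : Tendsto (fun z : ℝ × ℝ => z.2) (𝓝 0) (𝓝 0) := continuous_snd.tendsto 0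
    have e3 : Tendsto (fun z : ℝ × ℝ => |z.1|) (𝓝 0) (𝓝 0) := by simpa using e1.abs
    have e4 : Tendsto (fun z : ℝ × ℝ => |z.2|) (𝓝 0) (𝓝 0) := by simpa using e2.abs
    have e5 := hqc.tendsto.comp e2
    have e6 := hPc.tendsto.comp e2
    refine ((e3.eventually_lt_const Real.pi_pos).and (e4.eventually_lt_const (by norm_num))).and
      (((e5.eventually_const_lt hqpos).and ((e6.eventually_const_lt hP0).and
        (e6.eventually_lt_const (lt_add_one _)))).and ?_)
    filter_upwards [hquad] with z hz
    have e7 : (Z 0).1 = 0 := by simp only [Z, hΓ0, eModelField_zero_half]; rfl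
    rw [hd.fderiv, e7] at hz
    simp only [sub_zero, _root_.sub_apply, _root_.smul_apply,
      ContinuousLinearMap.coe_fst', ContinuousLinearMap.coe_snd', smul_eq_mul, Real.norm_eq_abs]
      at hz
    refine (le_of_eq ?_).trans (hz.trans ?_)
    · congr 1; ring
    · refine mul_le_mul_of_nonneg_left ?_ hC.le
      rw [Prod.norm_def, Real.norm_eq_abs, Real.norm_eq_abs]
      rcases max_cases |z.1| |z.2| with h | h <;> rw [h.1, sq_abs] <;> nlinarith
  obtain ⟨ρ, hρ, hball⟩ := Metric.eventually_nhds_iff_ball.1 hev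
  have hall : ∀ x y : ℝ, |x| < ρ → |y| < ρ → _ := fun x y hx hy => hball (x, y) (by
    rw [mem_ball_zero_iff, Prod.norm_def]; exact max_lt hx hy)
  have hlam : 0 < 3 * Q / 2 := by positivity
  have ha : 0 < 12 * μ / Real.sqrt n := by positivity
  -- One constant for both estimates: `C` is the Taylor error of `X`, and `(P 0 + 1) * n` bounds `Y
  -- / x²`.
  set M := C + (P 0 + 1) * n with hM
  have hM0 : 0 < M := by positivity
  have hX1 : ∀ x y, |x| < ρ → |y| < ρ → ContDiffAt ℝ 1 (fun z : ℝ × ℝ => (Z (z.1, z.2)).1) (x, y) :=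
    fun x y hx hy => ((hZ (x, y) (hall x y hx hy).1.2 (hall x y hx hy).2.1.1).fst).of_le (by simp)
  have hY1 : ∀ x y, |x| < ρ → |y| < ρ →
      ContDiffAt ℝ 1 (fun z : ℝ × ℝ => (Z (z.1, z.2)).2.1) (x, y) :=
    fun x y hx hy =>
      ((hZ (x, y) (hall x y hx hy).1.2 (hall x y hx hy).2.1.1).snd.fst).of_le (by simp)
  have hX : ∀ x y, |x| < ρ → |y| < ρ →
      |(Z (x, y)).1 + 3 * Q / 2 * x + 12 * μ / Real.sqrt n * y| ≤ M * (x ^ 2 + y ^ 2) :=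
    fun x y hx hy => (hall x y hx hy).2.2.trans (by
      gcongr
      have : 0 ≤ (P 0 + 1) * n := by positivity
      linarith)
  have hYP : ∀ x y, (Z (x, y)).2.1 = P y * (1 - Real.cos x ^ (2 * n)) := fun x y => by
    simp only [Z, Γ, P, eModelField]; ring
  have hY : ∀ x y, |x| < ρ → |y| < ρ → x ≠ 0 → 0 < (Z (x, y)).2.1 ∧ (Z (x, y)).2.1 ≤ M * x ^ 2 := by
    intro x y hx hy h0
    obtain ⟨⟨h1, -⟩, ⟨-, h2, h3⟩, -⟩ := hall x y hx hy
    rw [hYP]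
    refine ⟨mul_pos h2 (one_sub_cos_pow_pos hn h0 h1), ?_⟩
    calc P y * (1 - Real.cos x ^ (2 * n)) ≤ (P 0 + 1) * (n * x ^ 2) :=
          mul_le_mul h3.le (one_sub_cos_pow_le n x) (one_sub_cos_pow_pos hn h0 h1).le (by positivity)
      _ = (P 0 + 1) * n * x ^ 2 := by ring
      _ ≤ M * x ^ 2 := by gcongr; linarith
  have hY0 : ∀ y, |y| < ρ → (Z (0, y)).2.1 = 0 := fun y _ => by rw [hYP]; simp
  have h0ρ : |(0 : ℝ)| < ρ := by simpa using hρ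
  have hqd : ∀ y, |y| < ρ → HasDerivAt q (eModelLeafDeriv n Q y) y := fun y hy =>
    hasDerivAt_eModelLeaf hn (hall 0 y h0ρ hy).1.2 (hall 0 y h0ρ hy).2.1.1
  -- Invariance of the surface: the `Q` component equals `q'` times the `T` component.
  have hf : ∀ x y, |x| < ρ → |y| < ρ → eModelField n μ (x, 1 / 2 + y, q y) =
      ((Z (x, y)).1, (Z (x, y)).2.1, eModelLeafDeriv n Q y * (Z (x, y)).2.1) := by
    intro x y hx hy
    obtain ⟨⟨-, h1⟩, ⟨h2, -, -⟩, -⟩ := hall x y hx hy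
    have e1 : (1 / 2 : ℝ) - y ≠ 0 := by linarith [(abs_lt.1 h1).2]
    have e2 : (1 / 2 : ℝ) + y ≠ 0 := by linarith [(abs_lt.1 h1).1]
    refine Prod.ext rfl (Prod.ext rfl ?_)
    change -3 * (q y ^ 2 - 1) * (1 / 2 + y - 1) * (1 - Real.cos x ^ (2 * n)) = _
    dsimp only
    rw [hYP, eModelLeafDeriv, ← hq, show P y = 3 * q y * (1 / 2 - y) ^ 2 * (1 / 2 + y) / n by
      simp only [P]; ring]
    have h2' := h2.ne'
    generalize 1 - Real.cos x ^ (2 * n) = W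
    rw [show 1 / 2 + y - 1 = -(1 / 2 - y) by ring]
    generalize 1 / 2 - y = B at e1 ⊢
    generalize 1 / 2 + y = A at e2 ⊢
    field_simp
  have hs := hasEnteringCurve_strongStable hlam ha hM0 hρ hX1 hY1 hX hY hqd hf
  have hc := hasEnteringCurve_center hlam ha hM0 hρ hX1 hY1 hX hY hY0 hqd hf
  rw [hq0] at hs hc
  exact ⟨hs, hc⟩

theorem isSaddle_eModelField {n : ℕ} (hn : 1 ≤ n) {μ : ℝ} (hμ : 0 < μ) {Q : ℝ} (hQ : Q ≠ 0) :
    IsSaddle (eModelField n μ) (0, 1 / 2, Q) := by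
  have hs0 : Real.sqrt n ≠ 0 := (Real.sqrt_pos.2 (by exact_mod_cast hn)).ne'
  have hp := eModelField_zero_half n μ Q
  have hd := hasFDerivAt_eModelField hn μ Q
  rcases hQ.lt_or_gt with hneg | hpos
  -- The reflection reverses time, so the roles swap: the center orbit now enters the equilibrium,
  -- with eigenvalue `0`, and the strong orbit leaves it, with eigenvalue `-3Q/2 > 0`.
  · obtain ⟨h1, h2⟩ := hasEnteringCurve_eModelField hn hμ (neg_pos.2 hneg)
    have h1' := h1.map (g := fun z => -eModelField n μ z) eModelReflection
      eModelReflection_injective fun z => by rw [eModelField_reflection, neg_neg]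
    have h2' := h2.map (g := eModelField n μ) eModelReflection
      eModelReflection_injective fun z => by rw [eModelField_reflection, map_neg]
    simp only [eModelReflection_apply, neg_neg, neg_zero] at h1' h2'
    refine isSaddle_of_hasEnteringCurve (c := 0) (d := -(3 * Q / 2)) hp hd (by simp) (by simp)
      ?_ ?_
      (neg_ne_zero.2 (div_ne_zero (mul_ne_zero three_ne_zero hQ) two_ne_zero)).symm
      h2' h1'
    · rw [eModelLinearization_apply, zero_smul]
      refine Prod.ext ?_ rfl
      simp only [Prod.fst_zero]
      field_simp
      ring
    · rw [eModelLinearization_apply]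
      simp
  · obtain ⟨h1, h2⟩ := hasEnteringCurve_eModelField hn hμ hpos
    refine isSaddle_of_hasEnteringCurve (c := -(3 * Q / 2)) (d := 0) hp hd (by simp) (by simp)
      ?_ ?_ (by simpa using hQ) h1 h2
    · rw [eModelLinearization_apply]
      simp
    · rw [eModelLinearization_apply, zero_smul]
      refine Prod.ext ?_ rfl
      simp only [Prod.fst_zero]
      field_simp
      ring

end

theorem proposition10 (n : ℕ) (hn : 1 ≤ n) (μ : ℝ) (hμ : 0 < μ) :
    (IsUnstableEquilibrium (eModelField n μ) (0, 1 / 2, 1) ∧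
      IsSaddle (eModelField n μ) (0, 1 / 2, 1)) ∧
    (∀ Qs : ℝ, Qs ≠ 0 → Qs ≠ 1 → Qs ≠ -1 →
      IsUnstableEquilibrium (eModelField n μ) (0, 1 / 2, Qs) ∧
      IsSaddle (eModelField n μ) (0, 1 / 2, Qs)) := by
  have h := isSaddle_eModelField hn hμ one_ne_zero
  refine ⟨⟨h.isUnstableEquilibrium, h⟩, fun Qs h0 _ _ => ?_⟩
  have h := isSaddle_eModelField hn hμ h0
  exact ⟨h.isUnstableEquilibrium, h⟩
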